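/- Fix an optimal description language (a partial computable map from binary programs to binary strings for which the minimal program length is smallest up to an additive constant), and let $C(x)$ be the corresponding (plain) Kolmogorov complexity of a binary string $x$. Fix a discrete a priori probability $\mathbf m$, i.e. a lower semicomputable semimeasure on binary strings that is maximal up to a constant factor among all lower semicomputable semimeasures. Fix a computable encoding of finite sets of strings by strings; for a finite set $A$ of strings, $C(A)$ and $\mathbf m(A)$ denote the values of $C$ and $\mathbf m$ at the code of $A$. Let $\mathcal A$ be a decidable family of finite sets of binary strings that contains every singleton $\{x\}$. Let $\mathcal A^n$ be the family of those $A\in\mathcal A$ all of whose elements have length $n$. For a string $x$ of length $n$ and $A\in\mathcal A^n$ with $x\in A$ put $$\delta(x,A)=C(A)+\log_2|A|-C(x).$$ The $\mathcal A$-algorithmic prediction $d$-neighbourhood of $x$ is the union of all sets $A\in\mathcal A^n$ with $x\in A$ and $\delta(x,A)\le d$. The $\mathcal A$-probabilistic prediction $d$-neighbourhood of $x$ is the set of all strings $y$ with $p_{\mathcal A}(y\mid x)\ge 2^{-d}$, where $$p_{\mathcal A}(y\mid x)=\frac{\sum_{A\ni x,y}\mathbf m(A)/|A|}{\sum_{A\ni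 x}\mathbf m(A)/|A|},$$ both sums being taken over the sets $A\in\mathcal A^n$ with $C(A)\le 4n$; if no such set contains $x$, then $p_{\mathcal A}(y\mid x)$ is taken to be $0$, so that this neighbourhood is empty. Theorem. There are a constant $c$ and a number $N$, depending only on $\mathcal A$ and on the fixed choices above, such that: (a) for every $n\ge N$, every string $x$ of length $n$ and every real $d$, the $\mathcal A$-algorithmic prediction $d$-neighbourhood of $x$ is contained in the $\mathcal A$-probabilistic prediction $(d+c\log_2 n)$-neighbourhood of $x$; (b) for every $n\ge 2$, every string $x$ of length $n$ and every real $d$, the $\mathcal A$-probabilistic prediction $d$-neighbourhood of $x$ is contained in the $\mathcal A$-algorithmic prediction $(d+c\log_2 n)$-neighbourhood of $x$. -/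

import Mathlib

/-! ### Plain Kolmogorov complexity of binary strings -/

/-- An optimal description language: a partial computable map from programs to strings such that
every other partial computable map can be simulated with programs that are longer by at most a
constant. -/
def IsOptimalLanguage (D : List Bool →. List Bool) : Prop :=
  Partrec D ∧
    ∀ D' : List Bool →. List Bool, Partrec D' →
      ∃ c : ℕ, ∀ p x : List Bool, x ∈ D' p → ∃ q : List Bool, x ∈ D q ∧ q.length ≤ p.length + c

/-- The complexity `C(x)` of `x`: the minimal length of a program that produces `x`. (For an
optimal language every string has a program.) -/
noncomputable def kolmogorovC (D : List Bool →. List Bool) (x : List Bool) : ℕ :=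
  sInf {k : ℕ | ∃ p : List Bool, x ∈ D p ∧ p.length = k}

/-! ### Discrete a priori probability -/

/-- Lower semicomputable semimeasures on binary strings: non-negative, of total mass at most `1`,
and such that the set of pairs `(r, x)` with `r < m x`, `r` rational, is enumerable. The rational
is given by its numerator `a` and denominator `b + 1`; negative rationals may be left out since
`m` is non-negative. -/
structure IsLowerSemicomputableSemimeasure (m : List Bool → ℝ) : Prop where
  nonneg : ∀ x, 0 ≤ m x
  summable : Summable m
  tsum_le_one : ∑' x, m x ≤ 1
  enumerable : REPred fun q : (ℕ × ℕ) × List Bool => (q.1.1 : ℝ) / ((q.1.2 : ℝ) + 1) < m q.2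

/-- `m` is a discrete a priori probability: a lower semicomputable semimeasure that is maximal
up to a constant factor. -/
def IsAPrioriProbability (m : List Bool → ℝ) : Prop :=
  IsLowerSemicomputableSemimeasure m ∧
    ∀ m' : List Bool → ℝ, IsLowerSemicomputableSemimeasure m' →
      ∃ c : ℝ, 0 < c ∧ ∀ x, m' x ≤ c * m x

/-! ### Finite sets of strings as finite objects -/

/-- A computable encoding of finite sets of strings by strings: an injective map whose value on a
finite set can be computed from any list of the elements of the set. -/
def IsSetEncoding (e : Finset (List Bool) → List Bool) : Prop :=
  Function.Injective e ∧ Computable fun l : List (List Bool) => e l.toFinset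

/-- A family of finite sets of strings is decidable: there is an algorithm that, given a list of
the elements of a finite set, decides whether the set belongs to the family. -/
def IsDecidableFamily (𝒜 : Set (Finset (List Bool))) : Prop :=
  ComputablePred fun l : List (List Bool) => l.toFinset ∈ 𝒜

/-- The set `𝔹ⁿ` of all `n`-bit strings. -/
noncomputable def bitStrings (n : ℕ) : Finset (List Bool) :=
  (List.finite_length_eq Bool n).toFinset

/-- The optimality deficiency `δ(x, A) = C(A) + log₂ |A| - C(x)`. -/
noncomputable def optimalityDeficiency (D : List Bool →. List Bool)
    (e : Finset (List Bool) → List Bool) (x : List Bool) (A : Finset (List Bool)) : ℝ :=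
  (kolmogorovC D (e A) : ℝ) + Real.logb 2 (A.card : ℝ) - (kolmogorovC D x : ℝ)

/-! ### The two prediction neighbourhoods -/

/-- The `𝒜`-algorithmic prediction `d`-neighbourhood of `x`: the union of all `A ∈ 𝒜` consisting
of strings of the same length as `x`, containing `x`, with `δ(x, A) ≤ d`. -/
def algorithmicNeighborhood (D : List Bool →. List Bool) (e : Finset (List Bool) → List Bool)
    (𝒜 : Set (Finset (List Bool))) (x : List Bool) (d : ℝ) : Set (List Bool) :=
  {y | ∃ A ∈ 𝒜, A ⊆ bitStrings x.length ∧ x ∈ A ∧ y ∈ A ∧ optimalityDeficiency D e x A ≤ d}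

open Classical in
/-- The sets `A ∈ 𝒜` that consist of strings of length `n`, where `n` is the length of `x`, have
complexity at most `4 n`, and contain `x`. -/
noncomputable def admissibleModels (D : List Bool →. List Bool)
    (e : Finset (List Bool) → List Bool) (𝒜 : Set (Finset (List Bool))) (x : List Bool) :
    Finset (Finset (List Bool)) :=
  (bitStrings x.length).powerset.filter
    fun A => A ∈ 𝒜 ∧ kolmogorovC D (e A) ≤ 4 * x.length ∧ x ∈ A

open Classical in
/-- The conditional probability `p_𝒜(y | x)`: the sum of `m(A) / |A|` over the admissible sets
that contain `x` and `y`, divided by the sum over those that contain `x`. -/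
noncomputable def predictionProbability (D : List Bool →. List Bool) (m : List Bool → ℝ)
    (e : Finset (List Bool) → List Bool) (𝒜 : Set (Finset (List Bool))) (x y : List Bool) : ℝ :=
  (∑ A ∈ (admissibleModels D e 𝒜 x).filter (fun A => y ∈ A), m (e A) / (A.card : ℝ)) /
    (∑ A ∈ admissibleModels D e 𝒜 x, m (e A) / (A.card : ℝ))

/-- The `𝒜`-probabilistic prediction `d`-neighbourhood of `x`. -/
def probabilisticNeighborhood (D : List Bool →. List Bool) (m : List Bool → ℝ)
    (e : Finset (List Bool) → List Bool) (𝒜 : Set (Finset (List Bool))) (x : List Bool) (d : ℝ) :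
    Set (List Bool) :=
  {y | (2 : ℝ) ^ (-d) ≤ predictionProbability D m e 𝒜 x y}

/-! ### Recursively enumerable predicates -/

section Enumerability

open Encodable

variable {α β γ : Type*} [Primcodable α] [Primcodable β] [Primcodable γ]

/-! Comparisons are up to factors polynomial in n, hence up to O(log n) in exponents. Put w(A) =
2^(-C(A)) / |A|, so that 2^(-δ(x,A)) = w(A) · 2^C(x). The claim is that p(y|x) is comparable to the
maximum of w(A) · 2^C(x) over the models A containing x and y.

By `IsAPrioriProbability.one_le_mul` and `IsAPrioriProbability.mul_two_pow_le`, m(A) is comparable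
to 2^(-C(A)), so numerator and denominator are essentially sums of w(A). The numerator is at least
each of its terms. It is also not much more than a single w(A), and this is the core of the proof:
group the models by complexity k and by size up to a factor 2, which gives only O(n²) groups. If T
models of one group contain both x and y, then by `IsOptimalLanguage.exists_simpler_model` some
model of no larger size contains both and has complexity at most k - log T + O(log n); its w
accounts for the whole group (`IsAPrioriProbability.exists_predictionWeight_le`).

The simpler model comes from covers. Enumerate the at most 2^(k+1) models of complexity at most k.
The final list is not computable, but each aligned block of 2^τ entries is known as soon as it is
full. For each full block choose about 2^(τ-t) of its models, up to a factor 2n+1, so that every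
pair of strings lying in 2^t models of the block lies in a chosen one (`exists_cover`, greedy). Some
block holds about T/k of the T models (`exists_listBlock_lt_countP`), so t is nearly log T, while
all blocks together yield about 2^(k-t) chosen models; the position among these describes one of
them.

The denominator is the case y = x. It is at most about 2^(-C(x)), as C(x) ≤ C(A) + log|A| + O(log n)
for x in A, and at least about 2^(-C(x)) because of the singleton {x}. The bound C(A) ≤ 4n is
harmless: a more complex A can be replaced by the first model found that contains x and y
(`IsOptimalLanguage.exists_mem_complexity_le`). -/

theorem REPred.comp {p : β → Prop} {f : α → β} (hp : REPred p) (hf : Computable f) :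
    REPred fun a => p (f a) :=
  Partrec.comp hp hf

theorem REPred.and {p q : α → Prop} (hp : REPred p) (hq : REPred q) :
    REPred fun a => p a ∧ q a := by
  have h : Partrec fun a => (Part.assert (p a) fun _ => Part.some ()).bind
      fun _ => Part.assert (q a) fun _ => Part.some () :=
    Partrec.bind hp (Partrec.comp hq Computable.fst).to₂
  refine h.dom_re.of_eq fun a => ?_
  simp [Part.dom_iff_mem, Part.mem_assert_iff]

/-- A recursively enumerable predicate is the projection of a computable one. -/
theorem REPred.exists_computable {p : α → Prop} (hp : REPred p) :
    ∃ f : α → ℕ → Bool, Computable₂ f ∧ ∀ a, p a ↔ ∃ n, f a n = true := by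
  obtain ⟨c, hc⟩ := Nat.Partrec.Code.exists_code.1 hp
  refine ⟨fun a n => (c.evaln n (encode a)).isSome, ?_, fun a => ?_⟩
  · exact Primrec.option_isSome.to_comp.comp (Nat.Partrec.Code.primrec_evaln.to_comp.comp
      ((Computable.snd.pair (Computable.const c)).pair (Computable.encode.comp Computable.fst)))
  · have h1 : (c.eval (encode a)).Dom ↔ p a := by
      rw [hc]
      simp [Part.dom_iff_mem, Part.mem_assert_iff]
    rw [← h1, Part.dom_iff_mem]
    simp only [Nat.Partrec.Code.evaln_complete, Option.isSome_iff_exists, Option.mem_def]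
    exact exists_comm

/-- A recursively enumerable relation contains the graph of a partial computable function with the
same domain. -/
theorem REPred.exists_partrec {p : α × β → Prop} (hp : REPred p) :
    ∃ g : α →. β, Partrec g ∧ (∀ a, ∀ b ∈ g a, p (a, b)) ∧
      ∀ a, (g a).Dom ↔ ∃ b, p (a, b) := by
  obtain ⟨f, hf, hpf⟩ := hp.exists_computable
  -- The search index codes a candidate `b` together with a halting time for `p (a, b)`.
  let h : α → ℕ → Option β := fun a n =>
    (decode (α := β) n.unpair.1).bind fun b => cond (f (a, b) n.unpair.2) (some b) none
  have hh : Computable₂ h := by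
    refine Computable.option_bind (Computable.decode.comp (Computable.fst.comp
      (Computable.unpair.comp Computable.snd))) ?_
    refine Computable.cond ?_ (Computable.option_some.comp Computable.snd) (Computable.const none)
    exact hf.comp ((Computable.fst.comp Computable.fst).pair Computable.snd)
      (Computable.snd.comp (Computable.unpair.comp (Computable.snd.comp Computable.fst)))
  have key : ∀ a n b, b ∈ h a n → p (a, b) := by
    intro a n b hb
    simp only [h, Option.mem_def, Option.bind_eq_some_iff] at hb
    obtain ⟨b', -, hb'⟩ := hb
    cases hfb : f (a, b') n.unpair.2 with
    | false => simp [hfb] at hb'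
    | true =>
      simp only [hfb, cond_true, Option.some.injEq] at hb'
      subst hb'
      exact (hpf _).2 ⟨_, hfb⟩
  refine ⟨fun a => Nat.rfindOpt (h a), Partrec.rfindOpt hh, fun a b hb => ?_, fun a => ?_⟩
  · obtain ⟨n, hn⟩ := Nat.rfindOpt_spec hb
    exact key a n b hn
  · rw [Nat.rfindOpt_dom]
    constructor
    · rintro ⟨n, b, hb⟩
      exact ⟨b, key a n b hb⟩
    · rintro ⟨b, hb⟩
      obtain ⟨n, hn⟩ := (hpf _).1 hb
      exact ⟨Nat.pair (encode b) n, b, by simp [h, hn]⟩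

theorem REPred.exists {p : α × β → Prop} (hp : REPred p) : REPred fun a => ∃ b, p (a, b) := by
  obtain ⟨g, hg, -, hdom⟩ := hp.exists_partrec
  exact hg.dom_re.of_eq hdom

theorem Partrec.mem_re [DecidableEq β] {f : α →. β} (hf : Partrec f) :
    REPred fun q : α × β => q.2 ∈ f q.1 := by
  have h : Partrec fun q : α × β => (f q.1).bind fun b =>
      ((if b = q.2 then some () else Option.none : Option Unit) : Part Unit) := by
    refine Partrec.bind (hf.comp Computable.fst) ?_
    refine Computable.ofOption (Primrec.to_comp ?_)
    exact Primrec.ite (Primrec.eq.comp Primrec.snd (Primrec.snd.comp Primrec.fst))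
      (Primrec.const _) (Primrec.const _)
  refine h.dom_re.of_eq fun q => ?_
  rw [Part.dom_iff_mem]
  simp only [Part.mem_bind_iff]
  constructor
  · rintro ⟨_, b, hb, hq⟩
    split_ifs at hq with h
    · exact h ▸ hb
    · simp at hq
  · intro hq
    exact ⟨(), q.2, hq, by simp⟩

theorem Primrec.list_map_fst : Primrec (List.map Prod.fst : List (γ × β) → List γ) := by
  have h : Primrec₂ fun (_ : List (γ × β)) (q : γ × β) => q.1 := Primrec.fst.comp Primrec.snd
  exact Primrec.list_map (f := fun l : List (γ × β) => l) Primrec.id h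

theorem Primrec.mem_list : PrimrecRel fun (z : γ) (l : List γ) => z ∈ l := by
  have h : PrimrecRel fun (l : List γ) (z : γ) => ∃ y ∈ l, y = z :=
    PrimrecRel.exists_mem_list Primrec.eq
  exact (PrimrecRel.comp h Primrec.snd Primrec.fst).of_eq fun q => by simp

/-- One stage of the enumeration of a recursively enumerable set of pairs: a pair is appended
unless its first component is already present. -/
theorem REPred.exists_enumeration_step [DecidableEq γ] {W : α × (γ × β) → Prop} (hW : REPred W) :
    ∃ step : α → ℕ → List (γ × β) → List (γ × β),
      -- The component `r.1.2` plays no role; it gives the function the shape that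
      -- `Computable.nat_rec` takes.
      (Computable fun r : (α × ℕ) × (ℕ × List (γ × β)) => step r.1.1 r.2.1 r.2.2) ∧
      (∀ a n l, step a n l = l ∨ ∃ q, W (a, q) ∧ q.1 ∉ l.map Prod.fst ∧ step a n l = l ++ [q]) ∧
      ∀ a q, W (a, q) → ∃ n, ∀ l, q.1 ∈ (step a n l).map Prod.fst := by
  obtain ⟨f, hf, hWf⟩ := hW.exists_computable
  refine ⟨fun a n l => ((decode (α := γ × β) n.unpair.1).bind fun q =>
    cond (f (a, q) n.unpair.2 && !decide (q.1 ∈ l.map Prod.fst)) (some (l ++ [q])) none).getD l,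
    ?_, fun a n l => ?_, fun a q hq => ?_⟩
  · refine Computable.option_getD ?_ (Computable.snd.comp Computable.snd)
    refine Computable.option_bind (Computable.decode.comp (Computable.fst.comp
      (Computable.unpair.comp (Computable.fst.comp Computable.snd)))) ?_
    refine Computable.cond ?_ ?_ (Computable.const none)
    · refine Primrec.and.to_comp.comp (hf.comp ?_ ?_) (Primrec.not.to_comp.comp ?_)
      · exact (Computable.fst.comp (Computable.fst.comp Computable.fst)).pair Computable.snd
      · exact Computable.snd.comp (Computable.unpair.comp
          (Computable.fst.comp (Computable.snd.comp Computable.fst)))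
      · exact Primrec.mem_list.decide.to_comp.comp (Computable.fst.comp Computable.snd)
          (Primrec.list_map_fst.to_comp.comp
            (Computable.snd.comp (Computable.snd.comp Computable.fst)))
    · exact Computable.option_some.comp (Computable.list_concat.comp
        (Computable.snd.comp (Computable.snd.comp Computable.fst)) Computable.snd)
  · dsimp only
    cases hd : decode (α := γ × β) n.unpair.1 with
    | none => simp
    | some q =>
      by_cases hc : (f (a, q) n.unpair.2 && !decide (q.1 ∈ l.map Prod.fst)) = true
      · right
        refine ⟨q, (hWf _).2 ⟨n.unpair.2, ?_⟩, ?_, ?_⟩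
        · simp only [Bool.and_eq_true] at hc
          exact hc.1
        · simp only [Bool.and_eq_true, Bool.not_eq_true', decide_eq_false_iff_not] at hc
          exact hc.2
        · simp only [Option.bind_some, hc, cond_true, Option.getD_some]
      · left
        simp only [Bool.not_eq_true] at hc
        simp only [Option.bind_some, hc, cond_false, Option.getD_none]
  · obtain ⟨n, hn⟩ := (hWf _).1 hq
    refine ⟨Nat.pair (encode q) n, fun l => ?_⟩
    by_cases hin : q.1 ∈ l.map Prod.fst
    · simp only [Nat.unpair_pair, encodek, Option.bind_some, hin, decide_true, Bool.not_true,
        Bool.and_false, cond_false, Option.getD_none]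
    · simp only [Nat.unpair_pair, encodek, Option.bind_some, hn, hin, decide_false,
        Bool.not_false, Bool.and_self, cond_true, Option.getD_some]
      simp

/-- Enumeration of a uniformly enumerable family of sets of pairs, keeping only the first pair
with a given first component. -/
theorem REPred.exists_enumeration [DecidableEq γ] {W : α × (γ × β) → Prop} (hW : REPred W) :
    ∃ L : α → ℕ → List (γ × β), Computable₂ L ∧
      (∀ a m n, m ≤ n → L a m <+: L a n) ∧
      (∀ a n, ((L a n).map Prod.fst).Nodup) ∧
      (∀ a n, ∀ q ∈ L a n, W (a, q)) ∧
      ∀ a q, W (a, q) → ∃ n, q.1 ∈ (L a n).map Prod.fst := by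
  obtain ⟨step, hstep, hcase, hadd⟩ := hW.exists_enumeration_step
  let L : α → ℕ → List (γ × β) := fun a n => Nat.rec [] (fun n l => step a n l) n
  have hsucc : ∀ a n, L a (n + 1) = step a n (L a n) := fun a n => rfl
  have hL : Computable₂ L :=
    Computable.nat_rec (f := fun r : α × ℕ => r.2) (g := fun _ => ([] : List (γ × β)))
      (h := fun r q => step r.1 q.1 q.2) Computable.snd (Computable.const []) hstep
  refine ⟨L, hL, fun a m n hmn => ?_, fun a n => ?_, fun a n => ?_, fun a q hq => ?_⟩
  · induction hmn with
    | refl => exact List.prefix_rfl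
    | step _ ih =>
      refine ih.trans ?_
      rw [hsucc]
      rcases hcase a _ (L a _) with h | ⟨q, -, -, h⟩
      · rw [h]
      · rw [h]
        exact List.prefix_append _ _
  · induction n with
    | zero => exact List.nodup_nil
    | succ n ih =>
      rw [hsucc]
      rcases hcase a n (L a n) with h | ⟨q, -, hq, h⟩
      · rwa [h]
      · rw [h, List.map_append]
        refine List.Nodup.append ih (List.nodup_singleton _) ?_
        simpa using hq
  · induction n with
    | zero => simp [L]
    | succ n ih =>
      rw [hsucc]
      rcases hcase a n (L a n) with h | ⟨q, hq, -, h⟩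
      · rwa [h]
      · rw [h]
        intro r hr
        rcases List.mem_append.1 hr with hr | hr
        · exact ih r hr
        · rw [List.mem_singleton.1 hr]
          exact hq
  · obtain ⟨n, hn⟩ := hadd a q hq
    exact ⟨n + 1, hn (L a n)⟩

end Enumerability

/-! ### Self-delimiting headers -/

/-- The number with the given binary digits, most significant digit first. -/
def binaryValue (w : List Bool) : ℕ :=
  w.foldl (fun v b => 2 * v + b.toNat) 0

theorem binaryValue_primrec : Primrec binaryValue := by
  have h : Primrec₂ fun (_ : List Bool) (q : ℕ × Bool) => 2 * q.1 + q.2.toNat :=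
    Primrec.nat_add.comp
      (Primrec.nat_mul.comp (Primrec.const 2) (Primrec.fst.comp Primrec.snd))
      ((Primrec.dom_bool Bool.toNat).comp (Primrec.snd.comp Primrec.snd))
  exact Primrec.list_foldl (f := fun w : List Bool => w) (g := fun _ => (0 : ℕ)) Primrec.id
    (Primrec.const 0) h

theorem exists_binaryValue_eq (l i : ℕ) (hi : i < 2 ^ l) :
    ∃ w : List Bool, w.length = l ∧ binaryValue w = i := by
  induction l generalizing i with
  | zero =>
    refine ⟨[], rfl, ?_⟩
    simp only [pow_zero, Nat.lt_one_iff] at hi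
    exact hi.symm
  | succ l ih =>
    obtain ⟨w, hw, hv⟩ := ih (i / 2) (by rw [pow_succ] at hi; omega)
    refine ⟨w ++ [decide (i % 2 = 1)], by simp [hw], ?_⟩
    rw [binaryValue, List.foldl_append]
    change 2 * binaryValue w + _ = i
    rw [hv]
    rcases Nat.mod_two_eq_zero_or_one i with h | h <;> simp [h] <;> omega

/-- Split a word `1ᵐ 0 u v`, where `u` has length `m`, into the numbers written in `u` and `v`. -/
def splitHeader (p : List Bool) : ℕ × ℕ :=
  (binaryValue ((p.drop (p.findIdx (fun b => !b) + 1)).take (p.findIdx fun b => !b)),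
    binaryValue (p.drop (2 * p.findIdx (fun b => !b) + 1)))

theorem splitHeader_primrec : Primrec splitHeader := by
  have hf : Primrec fun p : List Bool => p.findIdx fun b => !b :=
    Primrec.list_findIdx (f := fun p : List Bool => p) Primrec.id (Primrec.not.comp Primrec.snd)
  refine Primrec.pair (binaryValue_primrec.comp (Primrec.list_take.comp hf
    (Primrec.list_drop.comp (Primrec.succ.comp hf) Primrec.id))) (binaryValue_primrec.comp
    (Primrec.list_drop.comp (Primrec.succ.comp (Primrec.nat_mul.comp (Primrec.const 2) hf))
      Primrec.id))

/-- The unary prefix announces the length of `u`, so only `s` pays twice its binary length. The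
coefficient of `i.size` must be 1: in the counting bound `i` is the main term and `s` a logarithmic
one. -/
theorem exists_splitHeader_eq (s i : ℕ) :
    ∃ p : List Bool, splitHeader p = (s, i) ∧ p.length = 2 * s.size + 1 + i.size := by
  obtain ⟨u, hu, hs⟩ := exists_binaryValue_eq s.size s s.lt_size_self
  obtain ⟨v, hv, hi⟩ := exists_binaryValue_eq i.size i i.lt_size_self
  refine ⟨List.replicate s.size true ++ false :: (u ++ v), ?_, by simp [hu, hv]; omega⟩
  have h : (List.replicate s.size true ++ false :: (u ++ v)).findIdx (fun b => !b) = s.size := by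
    induction s.size with
    | zero => simp [List.findIdx_cons]
    | succ m ih => simp [List.replicate_succ, List.findIdx_cons, ih]
  have e1 : (List.replicate s.size true ++ false :: (u ++ v)).drop (s.size + 1) = u ++ v := by
    rw [List.drop_append]
    simp
  have e2 : (List.replicate s.size true ++ false :: (u ++ v)).drop (2 * s.size + 1) = v := by
    rw [show 2 * s.size + 1 = (s.size + 1) + s.size by ring, ← List.drop_drop, e1, ← hu]
    simp
  simp only [splitHeader, h, e1, e2]
  rw [← hu, List.take_left, hs, hi]

theorem two_pow_size_le (i : ℕ) : 2 ^ i.size ≤ 2 * i + 1 := by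
  rcases Nat.eq_zero_or_pos i with rfl | hi
  · simp
  · have h1 : 0 < i.size := Nat.size_pos.2 hi
    have h2 : 2 ^ (i.size - 1) ≤ i := Nat.lt_size.1 (by omega)
    calc 2 ^ i.size = 2 * 2 ^ (i.size - 1) := by rw [← pow_succ']; congr 1; omega
      _ ≤ 2 * i + 1 := by omega

/-! ### Strings of a given length -/

theorem mem_bitStrings {n : ℕ} {x : List Bool} : x ∈ bitStrings n ↔ x.length = n := by
  simp [bitStrings]

theorem card_bitStrings (n : ℕ) : (bitStrings n).card = 2 ^ n := by
  have h : bitStrings n = (Finset.univ : Finset (List.Vector Bool n)).image List.Vector.toList := by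
    ext x
    rw [mem_bitStrings, Finset.mem_image]
    exact ⟨fun hx => ⟨⟨x, hx⟩, Finset.mem_univ _, rfl⟩, fun ⟨v, _, hv⟩ => hv ▸ v.toList_length⟩
  rw [h, Finset.card_image_of_injective _ List.Vector.toList_injective, Finset.card_univ,
    card_vector, Fintype.card_bool]

/-! ### Basic properties of plain complexity -/

section Complexity

variable {D : List Bool →. List Bool}

theorem kolmogorovC_le_length {p x : List Bool} (h : x ∈ D p) : kolmogorovC D x ≤ p.length :=
  Nat.sInf_le ⟨p, h, rfl⟩

theorem IsOptimalLanguage.exists_program (hD : IsOptimalLanguage D) (x : List Bool) :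
    ∃ p, x ∈ D p ∧ p.length = kolmogorovC D x := by
  obtain ⟨c, hc⟩ := hD.2 (fun p => Part.some p) Partrec.some
  obtain ⟨q, hq, -⟩ := hc x x (Part.mem_some x)
  exact Nat.sInf_mem (s := {k : ℕ | ∃ p : List Bool, x ∈ D p ∧ p.length = k}) ⟨_, q, hq, rfl⟩

theorem IsOptimalLanguage.exists_complexity_le (hD : IsOptimalLanguage D)
    {D' : List Bool →. List Bool} (hD' : Partrec D') :
    ∃ c : ℕ, ∀ p x, x ∈ D' p → kolmogorovC D x ≤ p.length + c := by
  obtain ⟨c, hc⟩ := hD.2 D' hD'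
  refine ⟨c, fun p x hx => ?_⟩
  obtain ⟨q, hq, hle⟩ := hc p x hx
  exact (kolmogorovC_le_length hq).trans hle

theorem IsOptimalLanguage.complexity_le_length (hD : IsOptimalLanguage D) :
    ∃ c : ℕ, ∀ x, kolmogorovC D x ≤ x.length + c := by
  obtain ⟨c, hc⟩ := hD.exists_complexity_le Partrec.some
  exact ⟨c, fun x => hc x x (Part.mem_some x)⟩

theorem IsOptimalLanguage.complexity_le_of_partrec (hD : IsOptimalLanguage D)
    {f : List Bool →. List Bool} (hf : Partrec f) :
    ∃ c : ℕ, ∀ x y, y ∈ f x → kolmogorovC D y ≤ kolmogorovC D x + c := by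
  obtain ⟨c, hc⟩ := hD.exists_complexity_le (hD.1.bind (hf.comp Computable.snd).to₂)
  refine ⟨c, fun x y hy => ?_⟩
  obtain ⟨p, hp, hl⟩ := hD.exists_program x
  rw [← hl]
  exact hc p y (Part.mem_bind hp hy)

theorem IsOptimalLanguage.complexity_le_iff (hD : IsOptimalLanguage D) (x : List Bool) (k : ℕ) :
    kolmogorovC D x ≤ k ↔ ∃ p, p.length ≤ k ∧ x ∈ D p := by
  constructor
  · intro h
    obtain ⟨p, hp, hl⟩ := hD.exists_program x
    exact ⟨p, hl ▸ h, hp⟩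
  · rintro ⟨p, hp, hx⟩
    exact (kolmogorovC_le_length hx).trans hp

theorem IsOptimalLanguage.complexity_le_re (hD : IsOptimalLanguage D) :
    REPred fun q : List Bool × ℕ => kolmogorovC D q.1 ≤ q.2 := by
  have h1 : REPred fun r : (List Bool × ℕ) × List Bool => r.2.length ≤ r.1.2 :=
    (Primrec.nat_le.comp (Primrec.list_length.comp Primrec.snd)
      (Primrec.snd.comp Primrec.fst)).computablePred.to_re
  have h2 : REPred fun r : (List Bool × ℕ) × List Bool => r.1.1 ∈ D r.2 :=
    (Partrec.mem_re hD.1).comp (Computable.snd.pair (Computable.fst.comp Computable.fst))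
  exact (h1.and h2).exists.of_eq fun q => (hD.complexity_le_iff q.1 q.2).symm

/-- The sum 1 + 2 + ... + 2^k is 2^(k+1) - 1; the added 1 lets the induction close. -/
theorem card_length_le (S : Finset (List Bool)) (k : ℕ) (h : ∀ p ∈ S, p.length ≤ k) :
    S.card + 1 ≤ 2 ^ (k + 1) := by
  induction k generalizing S with
  | zero =>
    have : S ⊆ {[]} := fun p hp => by simpa using h p hp
    have := Finset.card_le_card this
    simp at this ⊢
    omega
  | succ k ih =>
    have h1 : (S.filter fun p => p.length ≤ k).card + 1 ≤ 2 ^ (k + 1) :=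
      ih _ fun p hp => (Finset.mem_filter.1 hp).2
    have h2 : (S.filter fun p => ¬ p.length ≤ k).card ≤ 2 ^ (k + 1) := by
      rw [← card_bitStrings]
      refine Finset.card_le_card fun p hp => ?_
      obtain ⟨hpS, hpk⟩ := Finset.mem_filter.1 hp
      have := h p hpS
      exact mem_bitStrings.2 (by omega)
    have h3 := Finset.card_filter_add_card_filter_not (s := S) fun p : List Bool => p.length ≤ k
    rw [pow_succ 2 (k + 1)]
    omega

theorem IsOptimalLanguage.card_complexity_le (hD : IsOptimalLanguage D)
    (S : Finset (List Bool)) (k : ℕ) (h : ∀ x ∈ S, kolmogorovC D x ≤ k) :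
    S.card ≤ 2 ^ (k + 1) := by
  classical
  choose g hg hl using hD.exists_program
  have hinj : Set.InjOn g S := fun x _ y _ hxy => Part.mem_unique (hg x) (hxy ▸ hg y)
  rw [← Finset.card_image_of_injOn hinj]
  have := card_length_le (S.image g) k fun p hp => by
    obtain ⟨x, hx, rfl⟩ := Finset.mem_image.1 hp
    rw [hl]
    exact h x hx
  omega

/-- Counting bound: an element of a uniformly enumerable set with at most `N` elements is
determined by the parameter of the set and its number in the enumeration. -/
theorem IsOptimalLanguage.two_pow_complexity_le (hD : IsOptimalLanguage D)
    {α : Type*} [Primcodable α] {W : α × List Bool → Prop} (hW : REPred W) :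
    ∃ c : ℕ, ∀ a z N, W (a, z) →
      (∀ S : Finset (List Bool), (∀ y ∈ S, W (a, y)) → S.card ≤ N) →
      2 ^ kolmogorovC D z ≤ c * (Encodable.encode a + 1) ^ 2 * N := by
  have hW' : REPred fun q : α × (List Bool × Unit) => W (q.1, q.2.1) :=
    hW.comp (Computable.fst.pair (Computable.fst.comp Computable.snd))
  obtain ⟨L, hL, hmono, hnodup, hLW, hWL⟩ := hW'.exists_enumeration
  -- The decoder reads the parameter and a position from the program, then waits until the
  -- enumeration reaches that position.
  let h : List Bool → ℕ → Option (List Bool) := fun p n =>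
    (Encodable.decode (α := α) (splitHeader p).1).bind fun a =>
      ((L a n).map Prod.fst)[(splitHeader p).2]?
  have hh : Computable₂ h := by
    refine Computable.option_bind (Computable.decode.comp (Computable.fst.comp
      (splitHeader_primrec.to_comp.comp Computable.fst))) ?_
    exact Computable.list_getElem?.comp
      (Primrec.list_map_fst.to_comp.comp
        (hL.comp Computable.snd (Computable.snd.comp Computable.fst)))
      (Computable.snd.comp (splitHeader_primrec.to_comp.comp
        (Computable.fst.comp Computable.fst)))
  obtain ⟨c, hc⟩ := hD.exists_complexity_le (Partrec.rfindOpt hh)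
  refine ⟨2 ^ c * 16, fun a z N hz hN => ?_⟩
  obtain ⟨n, hn⟩ := hWL a (z, ()) hz
  obtain ⟨i, hi, hiz⟩ := List.mem_iff_getElem.1 hn
  have hiN : i + 1 ≤ N := by
    have h1 : ((L a n).map Prod.fst).toFinset.card ≤ N := by
      refine hN _ fun y hy => ?_
      obtain ⟨q, hq, rfl⟩ := List.mem_map.1 (List.mem_toFinset.1 hy)
      exact hLW a n q hq
    rw [List.toFinset_card_of_nodup (hnodup a n)] at h1
    omega
  obtain ⟨p, hp, hlen⟩ := exists_splitHeader_eq (Encodable.encode a) i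
  have hval : ∀ m, h p m = ((L a m).map Prod.fst)[i]? := fun m => by simp [h, hp]
  have hmem : z ∈ Nat.rfindOpt (h p) := by
    -- Successive stages are prefixes of each other, so a filled position never changes and the
    -- stage at which the search stops is immaterial.
    rw [Nat.rfindOpt_mono]
    · refine ⟨n, ?_⟩
      rw [hval, Option.mem_def, List.getElem?_eq_some_iff]
      exact ⟨hi, hiz⟩
    · intro y m m' hm hy
      rw [hval, Option.mem_def] at hy ⊢
      obtain ⟨t, ht⟩ := (hmono a m m' hm).map Prod.fst
      have him := (List.getElem?_eq_some_iff.1 hy).1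
      rw [← ht, List.getElem?_append_left him, hy]
  have hle := hc p z hmem
  calc 2 ^ kolmogorovC D z ≤ 2 ^ (p.length + c) := Nat.pow_le_pow_right (by norm_num) hle
    _ = 2 ^ c * (2 * (2 ^ (Encodable.encode a).size) ^ 2 * 2 ^ i.size) := by
      rw [hlen]
      ring
    _ ≤ 2 ^ c * (2 * (2 * Encodable.encode a + 1) ^ 2 * (2 * i + 1)) := by
      gcongr <;> exact two_pow_size_le _
    _ ≤ 2 ^ c * (2 * (2 * (Encodable.encode a + 1)) ^ 2 * (2 * N)) := by
      gcongr <;> omega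
    _ = 2 ^ c * 16 * (Encodable.encode a + 1) ^ 2 * N := by ring

end Complexity

/-- Turns a constant factor into a power of the base, so that all error terms can be carried as a
single power of n + 2. -/
theorem le_add_two_pow (a n : ℕ) : a ≤ (n + 2) ^ a :=
  a.lt_two_pow_self.le.trans (Nat.pow_le_pow_left (by omega) a)

theorem Primrec.nat_pow : Primrec₂ ((· ^ ·) : ℕ → ℕ → ℕ) :=
  Primrec₂.unpaired'.1 Nat.Primrec.pow

/-! ### A priori probability and complexity -/

section APriori

variable {D : List Bool →. List Bool} {m : List Bool → ℝ}

theorem sum_range_one_div_mul_succ (n : ℕ) :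
    ∑ k ∈ Finset.range n, (1 : ℝ) / ((k + 1) * (k + 2)) = 1 - 1 / (n + 1) := by
  induction n with
  | zero => simp
  | succ n ih =>
    rw [Finset.sum_range_succ, ih]
    push_cast
    field_simp
    ring

theorem weight_primrecPred : PrimrecPred fun r : ((ℕ × ℕ) × List Bool) × ℕ =>
    r.1.1.1 * (2 ^ (r.2 + 1) * ((r.2 + 1) * (r.2 + 2))) < r.1.1.2 + 1 := by
  have hs : Primrec fun r : ((ℕ × ℕ) × List Bool) × ℕ => r.2 + 1 :=
    Primrec.succ.comp Primrec.snd
  have hs' : Primrec fun r : ((ℕ × ℕ) × List Bool) × ℕ => r.2 + 2 :=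
    Primrec.succ.comp hs
  have hp : Primrec fun r : ((ℕ × ℕ) × List Bool) × ℕ => 2 ^ (r.2 + 1) :=
    Primrec.nat_pow.comp (Primrec.const 2) hs
  have ha : Primrec fun r : ((ℕ × ℕ) × List Bool) × ℕ => r.1.1.1 :=
    Primrec.fst.comp (Primrec.fst.comp Primrec.fst)
  have hb : Primrec fun r : ((ℕ × ℕ) × List Bool) × ℕ => r.1.1.2 + 1 :=
    Primrec.succ.comp (Primrec.snd.comp (Primrec.fst.comp Primrec.fst))
  exact Primrec.nat_lt.comp
    (Primrec.nat_mul.comp ha (Primrec.nat_mul.comp hp (Primrec.nat_mul.comp hs hs'))) hb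

/-- The weight `2⁻ᶜ⁽ᶻ⁾⁻¹ / ((C(z) + 1) (C(z) + 2))`. -/
noncomputable def complexityWeight (D : List Bool →. List Bool) (z : List Bool) : ℝ :=
  1 / ((2 : ℝ) ^ (kolmogorovC D z + 1) * ((kolmogorovC D z + 1) * (kolmogorovC D z + 2)))

theorem complexityWeight_nonneg (z : List Bool) : 0 ≤ complexityWeight D z := by
  unfold complexityWeight
  positivity

/-- At most 2^(k+1) strings have complexity k, so level k contributes at most 1/((k+1)(k+2)), and
these terms telescope to less than 1. -/
theorem IsOptimalLanguage.sum_complexityWeight_le_one (hD : IsOptimalLanguage D)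
    (S : Finset (List Bool)) : ∑ z ∈ S, complexityWeight D z ≤ 1 := by
  have hmaps : ∀ z ∈ S, kolmogorovC D z ∈ Finset.range (S.sup (kolmogorovC D) + 1) :=
    fun z hz => Finset.mem_range.2 (Nat.lt_succ_of_le (Finset.le_sup hz))
  rw [← Finset.sum_fiberwise_of_maps_to hmaps]
  calc _ ≤ ∑ k ∈ Finset.range (S.sup (kolmogorovC D) + 1), (1 : ℝ) / ((k + 1) * (k + 2)) := by
        refine Finset.sum_le_sum fun k _ => ?_
        have hcard : (({z ∈ S | kolmogorovC D z = k}.card : ℕ) : ℝ) ≤ 2 ^ (k + 1) := by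
          exact_mod_cast hD.card_complexity_le _ k fun z hz =>
            le_of_eq (Finset.mem_filter.1 hz).2
        have heq : ∀ z ∈ S.filter fun z => kolmogorovC D z = k, complexityWeight D z =
            1 / ((2 : ℝ) ^ (k + 1) * ((k + 1) * (k + 2))) := fun z hz => by
          rw [complexityWeight, (Finset.mem_filter.1 hz).2]
        rw [Finset.sum_congr rfl heq, Finset.sum_const, nsmul_eq_mul]
        rw [mul_one_div, div_le_div_iff₀ (by positivity) (by positivity), one_mul]
        exact mul_le_mul_of_nonneg_right hcard (by positivity)
    _ ≤ 1 := by
        rw [sum_range_one_div_mul_succ]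
        have : (0 : ℝ) ≤ 1 / ((S.sup (kolmogorovC D) + 1 : ℕ) + 1) := by positivity
        linarith

/-- Complexity can only be approximated from above. The weight decreases in the complexity, so any
upper bound k that certifies the inequality is a valid witness, which makes the relation enumerable.
-/
theorem lt_complexityWeight_iff (a b : ℕ)
    (z : List Bool) : (a : ℝ) / ((b : ℝ) + 1) < complexityWeight D z ↔
      ∃ k, kolmogorovC D z ≤ k ∧ a * (2 ^ (k + 1) * ((k + 1) * (k + 2))) < b + 1 := by
  have key : ∀ k : ℕ, (a : ℝ) / (b + 1) < 1 / ((2 : ℝ) ^ (k + 1) * ((k + 1) * (k + 2))) ↔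
      a * (2 ^ (k + 1) * ((k + 1) * (k + 2))) < b + 1 := by
    intro k
    rw [div_lt_div_iff₀ (by positivity) (by positivity), one_mul]
    exact_mod_cast Iff.rfl
  rw [complexityWeight, key]
  constructor
  · intro h
    exact ⟨_, le_rfl, h⟩
  · rintro ⟨k, hk, h⟩
    refine lt_of_le_of_lt ?_ h
    gcongr
    norm_num

/-- The weights `complexityWeight D` form a lower semicomputable semimeasure. -/
theorem IsOptimalLanguage.isLowerSemicomputableSemimeasure (hD : IsOptimalLanguage D) :
    IsLowerSemicomputableSemimeasure (complexityWeight D) := by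
  refine ⟨complexityWeight_nonneg,
    summable_of_sum_le complexityWeight_nonneg hD.sum_complexityWeight_le_one,
    Real.tsum_le_of_sum_le complexityWeight_nonneg hD.sum_complexityWeight_le_one, ?_⟩
  have hf : Computable fun r : ((ℕ × ℕ) × List Bool) × ℕ => (r.1.2, r.2) :=
    (Computable.snd.comp Computable.fst).pair Computable.snd
  have h1 := hD.complexity_le_re.comp hf
  exact (h1.and weight_primrecPred.computablePred.to_re).exists.of_eq
    fun q => (lt_complexityWeight_iff q.1.1 q.1.2 q.2).symm

/-- Maximality of `m`, applied to the semimeasure of weights 2^(-C(z)) / poly(C(z)). -/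
theorem IsAPrioriProbability.one_le_mul (hm : IsAPrioriProbability m) (hD : IsOptimalLanguage D) :
    ∃ c : ℕ, ∀ z, 1 ≤ ((kolmogorovC D z : ℝ) + 2) ^ c * 2 ^ kolmogorovC D z * m z := by
  obtain ⟨c, -, hc⟩ := hm.2 _ hD.isLowerSemicomputableSemimeasure
  obtain ⟨c', hc'⟩ := exists_nat_ge c
  refine ⟨c' + 3, fun z => ?_⟩
  have h := hc z
  have hmz := hm.1.nonneg z
  rw [complexityWeight, div_le_iff₀ (by positivity)] at h
  set k := kolmogorovC D z
  have hck : c ≤ ((k : ℝ) + 2) ^ c' := hc'.trans (by exact_mod_cast le_add_two_pow c' k)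
  calc (1 : ℝ) ≤ c * m z * (2 ^ (k + 1) * ((k + 1) * (k + 2))) := h
    _ ≤ ((k : ℝ) + 2) ^ c' * m z * (((k + 2) * 2 ^ k) * ((k + 2) * (k + 2))) := by
      rw [pow_succ' 2 k]
      gcongr <;> linarith [(k.cast_nonneg : (0 : ℝ) ≤ k)]
    _ = _ := by ring

theorem IsLowerSemicomputableSemimeasure.sum_le_one (hm : IsLowerSemicomputableSemimeasure m)
    (S : Finset (List Bool)) : ∑ z ∈ S, m z ≤ 1 :=
  (hm.summable.sum_le_tsum S fun z _ => hm.nonneg z).trans hm.tsum_le_one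

/-- The strings with probability above 2^(-k) are enumerable uniformly in k, and there are at most
2^k of them since the total mass is at most 1. -/
theorem IsLowerSemicomputableSemimeasure.two_pow_complexity_le
    (hm : IsLowerSemicomputableSemimeasure m) (hD : IsOptimalLanguage D) :
    ∃ c : ℕ, ∀ z k, 1 < 2 ^ k * m z → 2 ^ kolmogorovC D z ≤ c * (k + 1) ^ 2 * 2 ^ k := by
  have hW : REPred fun q : ℕ × List Bool => 1 < 2 ^ q.1 * m q.2 := by
    have hf : Computable fun q : ℕ × List Bool => (((1, 2 ^ q.1 - 1), q.2) : (ℕ × ℕ) × List Bool) :=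
      (((Primrec.const 1).pair (Primrec.pred.comp (Primrec.nat_pow.comp (Primrec.const 2)
        Primrec.fst))).pair Primrec.snd).to_comp
    refine (hm.enumerable.comp hf).of_eq ?_
    rintro ⟨k, z⟩
    have h : ((2 ^ k - 1 : ℕ) : ℝ) + 1 = 2 ^ k := by
      rw [Nat.cast_sub Nat.one_le_two_pow]
      push_cast
      ring
    simp only [h, Nat.cast_one]
    rw [div_lt_iff₀ (by positivity), mul_comm]
  obtain ⟨c, hc⟩ := hD.two_pow_complexity_le hW
  refine ⟨c, fun z k hz => ?_⟩
  have h := hc k z (2 ^ k) hz fun S hS => ?_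
  · simpa using h
  · have h1 : (S.card : ℝ) ≤ ∑ y ∈ S, 2 ^ k * m y := by
      rw [Finset.card_eq_sum_ones]
      push_cast
      exact Finset.sum_le_sum fun y hy => (hS y hy).le
    rw [← Finset.mul_sum] at h1
    have h2 := mul_le_mul_of_nonneg_left (hm.sum_le_one S) (by positivity : (0 : ℝ) ≤ 2 ^ k)
    rw [mul_one] at h2
    exact_mod_cast h1.trans h2

/-- For the least k with 2^(-k) < m(z), counting gives C(z) ≤ k + O(log k). The error is polynomial
in k rather than in C(z); the lower bound on m makes k at most linear in C(z), which repairs this.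
-/
theorem IsAPrioriProbability.mul_two_pow_le (hm : IsAPrioriProbability m)
    (hD : IsOptimalLanguage D) :
    ∃ c : ℕ, ∀ z, m z * 2 ^ kolmogorovC D z ≤ ((kolmogorovC D z : ℝ) + 2) ^ c := by
  obtain ⟨a, ha⟩ := hm.one_le_mul hD
  obtain ⟨b, hb⟩ := hm.1.two_pow_complexity_le hD
  refine ⟨2 * b + 2 * (a + 4) + 2, fun z => ?_⟩
  set C := kolmogorovC D z with hC
  have hmz : 0 < m z := by
    by_contra h
    have h0 : m z = 0 := le_antisymm (not_lt.1 h) (hm.1.nonneg z)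
    have := ha z
    rw [h0, mul_zero] at this
    linarith
  have hex : ∃ k : ℕ, 1 < 2 ^ k * m z := by
    obtain ⟨k, hk⟩ := pow_unbounded_of_one_lt (1 / m z) (by norm_num : (1 : ℝ) < 2)
    exact ⟨k, by rwa [div_lt_iff₀ hmz] at hk⟩
  classical
  have hspec := Nat.find_spec hex
  have hmin : ∀ j, j < Nat.find hex → 2 ^ j * m z ≤ 1 := fun j hj =>
    not_lt.1 (Nat.find_min hex hj)
  set k := Nat.find hex
  -- Since m(z) ≤ 1, the least exponent is positive and has a predecessor, at which the inequality
  -- fails.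
  have hk0 : k ≠ 0 := by
    intro h0
    rw [h0, pow_zero, one_mul] at hspec
    have := hm.1.sum_le_one {z}
    rw [Finset.sum_singleton] at this
    linarith
  obtain ⟨j, hj⟩ := Nat.exists_eq_succ_of_ne_zero hk0
  have hjm : 2 ^ j * m z ≤ 1 := hmin j (by omega)
  have hbk : (2 : ℝ) ^ C ≤ b * (k + 1) ^ 2 * 2 ^ k := by exact_mod_cast hb z k hspec
  have hjle : j ≤ (C + 2) * a + C := by
    have h1 : (2 : ℝ) ^ j ≤ 2 ^ ((C + 2) * a + C) := by
      calc (2 : ℝ) ^ j ≤ 2 ^ j * (((C : ℝ) + 2) ^ a * 2 ^ C * m z) :=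
            le_mul_of_one_le_right (by positivity) (ha z)
        _ = (2 ^ j * m z) * (((C : ℝ) + 2) ^ a * 2 ^ C) := by ring
        _ ≤ ((C : ℝ) + 2) ^ a * 2 ^ C := mul_le_of_le_one_left (by positivity) hjm
        _ ≤ (2 ^ (C + 2)) ^ a * 2 ^ C := by
            gcongr
            exact_mod_cast (Nat.lt_two_pow_self (n := C + 2)).le
        _ = _ := by rw [← pow_mul, ← pow_add]
    exact (pow_le_pow_iff_right₀ (by norm_num : (1 : ℝ) < 2)).1 h1
  have h2k : (2 : ℝ) ^ k = 2 * 2 ^ j := by rw [hj, Nat.succ_eq_add_one, pow_succ']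
  have hk1 : k + 1 ≤ (C + 2) ^ (a + 4) := by
    calc k + 1 ≤ (C + 2) * (a + 1) := by rw [hj]; nlinarith
      _ ≤ (C + 2) * (C + 2) ^ (a + 1) := Nat.mul_le_mul_left _ (le_add_two_pow _ _)
      _ = (C + 2) ^ (a + 2) := by ring
      _ ≤ (C + 2) ^ (a + 4) := Nat.pow_le_pow_right (by omega) (by omega)
  calc m z * 2 ^ C ≤ m z * (b * (k + 1) ^ 2 * 2 ^ k) := by gcongr
    _ = 2 * b * (k + 1) ^ 2 * (2 ^ j * m z) := by rw [h2k]; ring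
    _ ≤ 2 * b * (k + 1) ^ 2 := mul_le_of_le_one_right (by positivity) hjm
    _ ≤ ((C : ℝ) + 2) ^ (2 * b) * (((C : ℝ) + 2) ^ (a + 4)) ^ 2 := by
        gcongr
        · exact_mod_cast le_add_two_pow (2 * b) C
        · exact_mod_cast hk1
    _ = ((C : ℝ) + 2) ^ (2 * b + 2 * (a + 4)) := by ring
    _ ≤ _ := pow_le_pow_right₀ (by linarith [(C.cast_nonneg : (0 : ℝ) ≤ C)]) (by omega)

end APriori

/-! ### Complexity of finite sets and of their elements -/

section Sets

variable {D : List Bool →. List Bool} {e : Finset (List Bool) → List Bool}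

theorem Nat.pair_add_one_le (a b : ℕ) : Nat.pair a b + 1 ≤ (a + b + 1) ^ 2 := by
  have := Nat.pair_lt_max_add_one_sq a b
  have h : max a b + 1 ≤ a + b + 1 := by omega
  calc Nat.pair a b + 1 ≤ (max a b + 1) ^ 2 := this
    _ ≤ _ := Nat.pow_le_pow_left h 2

theorem IsOptimalLanguage.card_sets_complexity_le (hD : IsOptimalLanguage D)
    (he : Function.Injective e) (T : Finset (Finset (List Bool))) (k : ℕ)
    (h : ∀ A ∈ T, kolmogorovC D (e A) ≤ k) : T.card ≤ 2 ^ (k + 1) := by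
  classical
  rw [← Finset.card_image_of_injective T he]
  refine hD.card_complexity_le _ k fun x hx => ?_
  obtain ⟨A, hA, rfl⟩ := Finset.mem_image.1 hx
  exact h A hA

theorem IsOptimalLanguage.complexity_set_le_re (hD : IsOptimalLanguage D) (he : IsSetEncoding e) :
    REPred fun q : List (List Bool) × ℕ => kolmogorovC D (e q.1.toFinset) ≤ q.2 :=
  hD.complexity_le_re.comp ((he.2.comp Computable.fst).pair Computable.snd)

/-- The strings lying in some set of complexity at most k and size at most 2^i are enumerable, and a
union bound gives at most 2^(k+1) · 2^i of them. -/
theorem IsOptimalLanguage.two_pow_complexity_le_of_mem (hD : IsOptimalLanguage D)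
    (he : IsSetEncoding e) :
    ∃ c : ℕ, ∀ (A : Finset (List Bool)) (x : List Bool) (k i : ℕ), x ∈ A →
      kolmogorovC D (e A) ≤ k → A.card ≤ 2 ^ i →
      2 ^ kolmogorovC D x ≤ (k + i + 2) ^ c * 2 ^ (k + i) := by
  have hW : REPred fun q : (ℕ × ℕ) × List Bool => ∃ l : List (List Bool),
      kolmogorovC D (e l.toFinset) ≤ q.1.1 ∧ l.length ≤ 2 ^ q.1.2 ∧ q.2 ∈ l := by
    refine REPred.exists (p := fun r : ((ℕ × ℕ) × List Bool) × List (List Bool) =>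
      kolmogorovC D (e r.2.toFinset) ≤ r.1.1.1 ∧ r.2.length ≤ 2 ^ r.1.1.2 ∧ r.1.2 ∈ r.2) ?_
    refine ((hD.complexity_set_le_re he).comp (Computable.snd.pair
      (Computable.fst.comp (Computable.fst.comp Computable.fst)))).and (REPred.and ?_ ?_)
    · exact (Primrec.nat_le.comp (Primrec.list_length.comp Primrec.snd)
        (Primrec.nat_pow.comp (Primrec.const 2) (Primrec.snd.comp (Primrec.fst.comp
          Primrec.fst)))).computablePred.to_re
    · exact (Primrec.mem_list.comp (Primrec.snd.comp Primrec.fst)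
        Primrec.snd).computablePred.to_re
  obtain ⟨c, hc⟩ := hD.two_pow_complexity_le hW
  refine ⟨c + 5, fun A x k i hx hk hi => ?_⟩
  have h := hc (k, i) x (2 ^ (k + 1) * 2 ^ i) ⟨A.toList, by simpa using hk, by simpa using hi,
    by simpa using hx⟩ fun S hS => ?_
  · have hp : Encodable.encode (k, i) + 1 ≤ (k + i + 2) ^ 2 :=
      (Nat.pair_add_one_le k i).trans (Nat.pow_le_pow_left (by omega) 2)
    calc 2 ^ kolmogorovC D x
        ≤ c * (Encodable.encode (k, i) + 1) ^ 2 * (2 ^ (k + 1) * 2 ^ i) := h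
      _ ≤ (k + i + 2) ^ c * ((k + i + 2) ^ 2) ^ 2 * (((k + i + 2) * 2 ^ k) * 2 ^ i) := by
          rw [pow_succ' 2 k]
          gcongr
          · exact le_add_two_pow c (k + i)
          · omega
      _ = _ := by ring
  · classical
    choose! g hg using hS
    have hsub : S ⊆ (S.image fun y => (g y).toFinset).biUnion id := by
      intro y hy
      exact Finset.mem_biUnion.2 ⟨_, Finset.mem_image_of_mem _ hy, by simpa using (hg y hy).2.2⟩
    refine (Finset.card_le_card hsub).trans ((Finset.card_biUnion_le_card_mul _ _ (2 ^ i) ?_).trans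
      (Nat.mul_le_mul_right _ (hD.card_sets_complexity_le he.1 _ k ?_)))
    · intro B hB
      obtain ⟨y, hy, rfl⟩ := Finset.mem_image.1 hB
      exact (List.toFinset_card_le _).trans (hg y hy).2.1
    · intro B hB
      obtain ⟨y, hy, rfl⟩ := Finset.mem_image.1 hB
      exact (hg y hy).1

theorem IsOptimalLanguage.complexity_singleton_le (hD : IsOptimalLanguage D)
    (he : IsSetEncoding e) :
    ∃ c : ℕ, ∀ x, kolmogorovC D (e {x}) ≤ kolmogorovC D x + c := by
  have hf : Computable fun x : List Bool => e [x].toFinset :=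
    he.2.comp (Primrec.list_cons.comp Primrec.id (Primrec.const [])).to_comp
  obtain ⟨c, hc⟩ := hD.complexity_le_of_partrec hf.partrec
  exact ⟨c, fun x => hc x _ (by simp)⟩

/-- Given x and y, search for any member of the family that consists of n-bit strings and contains
both. The input is x ++ y with no separator: the halves have equal length, so 2n bits suffice up to
a constant. -/
theorem IsOptimalLanguage.exists_mem_complexity_le (hD : IsOptimalLanguage D)
    (he : IsSetEncoding e) {𝒜 : Set (Finset (List Bool))} (h𝒜 : IsDecidableFamily 𝒜) :
    ∃ c : ℕ, ∀ n, ∀ A ∈ 𝒜, A ⊆ bitStrings n → ∀ x ∈ A, ∀ y ∈ A,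
      ∃ B ∈ 𝒜, B ⊆ bitStrings n ∧ x ∈ B ∧ y ∈ B ∧ kolmogorovC D (e B) ≤ 2 * n + c := by
  have hR : REPred fun q : List Bool × List (List Bool) =>
      (q.1.take (q.1.length / 2) ∈ q.2 ∧ q.1.drop (q.1.length / 2) ∈ q.2 ∧
        ∀ u ∈ q.2, u.length = q.1.length / 2) ∧ q.2.toFinset ∈ 𝒜 := by
    have hl : Primrec fun q : List Bool × List (List Bool) => q.1.length / 2 :=
      Primrec.nat_div.comp (Primrec.list_length.comp Primrec.fst) (Primrec.const 2)
    have hall : PrimrecRel fun (l : List (List Bool)) (k : ℕ) => ∀ u ∈ l, u.length = k :=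
      PrimrecRel.forall_mem_list (R := fun (u : List Bool) (k : ℕ) => u.length = k)
        (Primrec.eq.comp (Primrec.list_length.comp Primrec.fst) Primrec.snd)
    refine REPred.and (PrimrecPred.computablePred ?_).to_re
      (ComputablePred.to_re h𝒜 |>.comp Computable.snd)
    exact (Primrec.mem_list.comp (Primrec.list_take.comp hl Primrec.fst) Primrec.snd).and
      ((Primrec.mem_list.comp (Primrec.list_drop.comp hl Primrec.fst) Primrec.snd).and
        (hall.comp Primrec.snd hl))
  obtain ⟨g, hg, hgR, hdom⟩ := hR.exists_partrec
  obtain ⟨c, hc⟩ := hD.exists_complexity_le (hg.map (he.2.comp Computable.snd).to₂)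
  refine ⟨c, fun n A hA hAn x hx y hy => ?_⟩
  have hxn := mem_bitStrings.1 (hAn hx)
  have hyn := mem_bitStrings.1 (hAn hy)
  have hlen : (x ++ y).length / 2 = n := by
    rw [List.length_append]
    omega
  have htake : (x ++ y).take n = x := by rw [← hxn, List.take_left]
  have hdrop : (x ++ y).drop n = y := by rw [← hxn, List.drop_left]
  have hD' : (g (x ++ y)).Dom := by
    rw [hdom]
    refine ⟨A.toList, ?_⟩
    simp only [hlen, htake, hdrop, Finset.mem_toList, Finset.toList_toFinset]
    exact ⟨⟨hx, hy, fun u hu => mem_bitStrings.1 (hAn hu)⟩, hA⟩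
  obtain ⟨l, hl⟩ := Part.dom_iff_mem.1 hD'
  obtain ⟨⟨h1, h2, h3⟩, h4⟩ := hgR _ l hl
  simp only [hlen, htake, hdrop] at h1 h2 h3
  refine ⟨l.toFinset, h4, fun u hu => mem_bitStrings.2 (h3 u (List.mem_toFinset.1 hu)),
    List.mem_toFinset.2 h1, List.mem_toFinset.2 h2, ?_⟩
  have := hc (x ++ y) (e l.toFinset) (Part.mem_map _ hl)
  rw [List.length_append] at this
  omega

end Sets

/-! ### Covers and dyadic portions -/

section Combinatorics

open Classical in
/-- If each point lies in at least `T` of at most `M` sets, then some set covers a fraction `T / M`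
of the points. -/
theorem exists_mul_card_le_card_filter {ι π : Type*} (F : Finset ι) (U : Finset π)
    (R : ι → π → Prop) {T M : ℝ} (hT0 : 0 < T) (hM : 0 < M) (hF : (F.card : ℝ) ≤ M)
    (hT : ∀ p ∈ U, T ≤ ((F.filter fun i => R i p).card : ℝ)) (hU : U.Nonempty) :
    ∃ i ∈ F, T / M * U.card ≤ ((U.filter fun p => R i p).card : ℝ) := by
  -- Double counting of incidences between sets and points.
  have hcount : T * U.card ≤ ∑ i ∈ F, ((U.filter fun p => R i p).card : ℝ) := by
    have h := Finset.sum_card_bipartiteAbove_eq_sum_card_bipartiteBelow R (s := F) (t := U)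
    simp only [Finset.bipartiteAbove, Finset.bipartiteBelow] at h
    have h' : ∑ i ∈ F, ((U.filter fun p => R i p).card : ℝ) =
        ∑ p ∈ U, ((F.filter fun i => R i p).card : ℝ) := by exact_mod_cast h
    rw [h', mul_comm, ← nsmul_eq_mul]
    exact Finset.card_nsmul_le_sum _ _ _ hT
  by_contra! hcon
  have hF0 : F.Nonempty := by
    obtain ⟨p, hp⟩ := hU
    have h := hT0.trans_le (hT p hp)
    have : 0 < (F.filter fun i => R i p).card := by exact_mod_cast h
    obtain ⟨i, hi⟩ := Finset.card_pos.1 this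
    exact ⟨i, (Finset.mem_filter.1 hi).1⟩
  have h := Finset.sum_lt_sum_of_nonempty hF0 hcon
  rw [Finset.sum_const, nsmul_eq_mul] at h
  have h2 : (F.card : ℝ) * (T / M * U.card) ≤ M * (T / M * U.card) :=
    mul_le_mul_of_nonneg_right hF (by positivity)
  have h3 : M * (T / M * U.card) = T * U.card := by field_simp
  linarith

open Classical in
/-- Greedy covering: each chosen set covers at least the fraction `T / M` of the remaining
points. -/
theorem exists_subset_card_uncovered_le {ι π : Type*} (F : Finset ι) (P : Finset π)
    (R : ι → π → Prop) {T M : ℝ} (hT0 : 0 < T) (hTM : T ≤ M) (hF : (F.card : ℝ) ≤ M)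
    (hT : ∀ p ∈ P, T ≤ ((F.filter fun i => R i p).card : ℝ)) (r : ℕ) :
    ∃ K ⊆ F, K.card ≤ r ∧
      ((P.filter fun p => ∀ i ∈ K, ¬ R i p).card : ℝ) ≤ P.card * (1 - T / M) ^ r := by
  have hM : 0 < M := hT0.trans_le hTM
  induction r with
  | zero => exact ⟨∅, Finset.empty_subset _, by simp, by simp⟩
  | succ r ih =>
    obtain ⟨K, hK, hKr, hU⟩ := ih
    set U := P.filter fun p => ∀ i ∈ K, ¬ R i p with hUdef
    have hq : 0 ≤ 1 - T / M := by
      rw [sub_nonneg, div_le_one hM]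
      exact hTM
    rcases U.eq_empty_or_nonempty with hUe | hUne
    · refine ⟨K, hK, hKr.trans (Nat.le_succ r), ?_⟩
      rw [← hUdef, hUe]
      simp only [Finset.card_empty, Nat.cast_zero]
      positivity
    · obtain ⟨i, hi, hcov⟩ := exists_mul_card_le_card_filter F U R hT0 hM hF
        (fun p hp => hT p (Finset.mem_filter.1 hp).1) hUne
      refine ⟨insert i K, Finset.insert_subset hi hK,
        (Finset.card_insert_le _ _).trans (Nat.succ_le_succ hKr), ?_⟩
      have hset : (P.filter fun p => ∀ j ∈ insert i K, ¬ R j p) = U.filter fun p => ¬ R i p := by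
        ext p
        simp only [hUdef, Finset.mem_filter, Finset.mem_insert, forall_eq_or_imp]
        tauto
      have hsplit : ((U.filter fun p => R i p).card : ℝ) + (U.filter fun p => ¬ R i p).card =
          U.card := by
        exact_mod_cast Finset.card_filter_add_card_filter_not (s := U) fun p => R i p
      rw [hset]
      calc ((U.filter fun p => ¬ R i p).card : ℝ) ≤ U.card * (1 - T / M) := by linarith
        _ ≤ P.card * (1 - T / M) ^ r * (1 - T / M) := mul_le_mul_of_nonneg_right hU hq
        _ = P.card * (1 - T / M) ^ (r + 1) := by ring

open Classical in
-- Each 2^(τ-t) greedy steps shrink the uncovered part by a factor of at most 1/e ≤ 1/2. After 2n+1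
-- such rounds at most 4^n · 2^(-(2n+1)) = 1/2 points remain, hence none.
theorem exists_cover {ι π : Type*} (F : Finset ι) (P : Finset π) (R : ι → π → Prop) {n t τ : ℕ}
    (htτ : t ≤ τ) (hF : F.card ≤ 2 ^ τ) (hP : P.card ≤ 4 ^ n)
    (hT : ∀ p ∈ P, 2 ^ t ≤ (F.filter fun i => R i p).card) :
    ∃ K ⊆ F, K.card ≤ (2 * n + 1) * 2 ^ (τ - t) ∧ ∀ p ∈ P, ∃ i ∈ K, R i p := by
  obtain ⟨K, hKF, hKr, hU⟩ := exists_subset_card_uncovered_le F P R (T := 2 ^ t) (M := 2 ^ τ)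
    (by positivity) (pow_le_pow_right₀ (by norm_num) htτ) (by exact_mod_cast hF)
    (fun p hp => by exact_mod_cast hT p hp) ((2 * n + 1) * 2 ^ (τ - t))
  refine ⟨K, hKF, hKr, ?_⟩
  have hratio : (2 : ℝ) ^ t / 2 ^ τ = ((2 : ℝ) ^ (τ - t))⁻¹ := by
    rw [pow_sub₀ _ (by norm_num) htτ]
    field_simp
  have hlt : (P.card : ℝ) * (1 - 2 ^ t / 2 ^ τ) ^ ((2 * n + 1) * 2 ^ (τ - t)) < 1 := by
    have h1 : (1 - (2 : ℝ) ^ t / 2 ^ τ) ^ (2 ^ (τ - t)) ≤ 1 / 2 := by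
      rw [hratio]
      have hs : (1 : ℝ) ≤ 2 ^ (τ - t) := one_le_pow₀ (by norm_num)
      have h0 : 0 ≤ 1 - ((2 : ℝ) ^ (τ - t))⁻¹ := sub_nonneg.2 (inv_le_one_of_one_le₀ hs)
      calc (1 - ((2 : ℝ) ^ (τ - t))⁻¹) ^ (2 ^ (τ - t))
          ≤ (Real.exp (-((2 : ℝ) ^ (τ - t))⁻¹)) ^ (2 ^ (τ - t)) := by
            refine pow_le_pow_left₀ h0 ?_ _
            linarith [Real.add_one_le_exp (-((2 : ℝ) ^ (τ - t))⁻¹)]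
        _ = Real.exp (-1) := by
            rw [← Real.exp_nat_mul]
            congr 1
            push_cast
            field_simp
        _ ≤ 1 / 2 := by
            rw [Real.exp_neg, one_div]
            refine inv_anti₀ (by norm_num) ?_
            linarith [Real.add_one_le_exp (1 : ℝ)]
    have h0 : 0 ≤ (1 - (2 : ℝ) ^ t / 2 ^ τ) ^ (2 ^ (τ - t)) := by
      refine pow_nonneg ?_ _
      rw [hratio]
      exact sub_nonneg.2 (inv_le_one_of_one_le₀ (one_le_pow₀ (by norm_num)))
    rw [mul_comm (2 * n + 1), pow_mul]
    calc (P.card : ℝ) * ((1 - 2 ^ t / 2 ^ τ) ^ (2 ^ (τ - t))) ^ (2 * n + 1)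
        ≤ 4 ^ n * (1 / 2) ^ (2 * n + 1) := by
          gcongr
          exact_mod_cast hP
      _ = 1 / 2 := by
          rw [pow_succ, pow_mul, ← mul_assoc, ← mul_pow]
          norm_num
      _ < 1 := by norm_num
  have hz := hU.trans_lt hlt
  have hz' : (P.filter fun p => ∀ i ∈ K, ¬ R i p).card = 0 := by
    have : (P.filter fun p => ∀ i ∈ K, ¬ R i p).card < 1 := by exact_mod_cast hz
    omega
  intro p hp
  by_contra! hcon
  have : p ∈ (P.filter fun p => ∀ i ∈ K, ¬ R i p) := Finset.mem_filter.2 ⟨hp, hcon⟩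
  rw [Finset.card_eq_zero.1 hz'] at this
  exact Finset.notMem_empty p this

/-- The `q`-th block of length `M` of a list. -/
def listBlock {ι : Type*} (l : List ι) (M q : ℕ) : List ι :=
  (l.drop (q * M)).take M

/-- In a list of length less than `2 ^ b`, some aligned block whose length is a power of two
contains more than a fraction `1 / b` of the elements with a given property. -/
theorem exists_listBlock_lt_countP {ι : Type*} (p : ι → Bool) (Q b : ℕ) (l : List ι)
    (hl : l.length < 2 ^ b) (hQ : b * Q < l.countP p) :
    ∃ τ < b, ∃ q, (q + 1) * 2 ^ τ ≤ l.length ∧ Q < (listBlock l (2 ^ τ) q).countP p := by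
  induction b generalizing l with
  | zero =>
    have : l = [] := List.length_eq_zero_iff.1 (by omega)
    simp [this] at hQ
  | succ b ih =>
    by_cases hlen : l.length < 2 ^ b
    · obtain ⟨τ, hτ, h⟩ := ih l hlen (by nlinarith)
      exact ⟨τ, hτ.trans (Nat.lt_succ_self b), h⟩
    by_cases hfirst : Q < (l.take (2 ^ b)).countP p
    · exact ⟨b, Nat.lt_succ_self b, 0, by omega, by simpa [listBlock] using hfirst⟩
    -- If the first 2^b entries hold at most Q of the elements, more than b · Q of them lie in the
    -- remainder, whose length is again below 2^b.
    · have hsplit : l.countP p = (l.take (2 ^ b)).countP p + (l.drop (2 ^ b)).countP p := by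
        rw [← List.countP_append, List.take_append_drop]
      obtain ⟨τ, hτ, q, hq, hQ'⟩ := ih (l.drop (2 ^ b))
        (by rw [List.length_drop]; rw [pow_succ] at hl; omega) (by
          rw [add_mul, one_mul] at hQ
          omega)
      -- Dropping 2^b entries preserves alignment, since 2^τ divides 2^b; block `q` of the remainder
      -- is block 2^(b-τ) + q of the whole list.
      have hpow : 2 ^ b = 2 ^ (b - τ) * 2 ^ τ := by
        rw [← pow_add]
        congr 1
        omega
      refine ⟨τ, hτ.trans (Nat.lt_succ_self b), 2 ^ (b - τ) + q, ?_, ?_⟩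
      · rw [List.length_drop] at hq
        have : (2 ^ (b - τ) + q + 1) * 2 ^ τ = 2 ^ b + (q + 1) * 2 ^ τ := by
          rw [hpow]
          ring
        omega
      · rw [listBlock, List.drop_drop] at hQ'
        rw [listBlock]
        have : (2 ^ (b - τ) + q) * 2 ^ τ = 2 ^ b + q * 2 ^ τ := by
          rw [hpow]
          ring
        rwa [this]

/-- A block that is full at one stage of an enumeration is final, so the cover computed from it is
independent of the stage. -/
theorem listBlock_eq_of_prefix {ι : Type*} {l l' : List ι} {M q : ℕ} (h : l <+: l')
    (hlen : (q + 1) * M ≤ l.length) : listBlock l M q = listBlock l' M q := by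
  obtain ⟨s, rfl⟩ := h
  have h1 : q * M + M ≤ l.length := by linarith
  rw [listBlock, listBlock, List.drop_append_of_le_length (by omega),
    List.take_append_of_le_length (by rw [List.length_drop]; omega)]

theorem length_listBlock {ι : Type*} {l : List ι} {M q : ℕ} (hlen : (q + 1) * M ≤ l.length) :
    (listBlock l M q).length = M := by
  have h1 : q * M + M ≤ l.length := by linarith
  rw [listBlock, List.length_take, List.length_drop]
  omega

end Combinatorics

/-! ### Many simple models yield one simpler model -/

section ManyModels

variable {D : List Bool →. List Bool} {e : Finset (List Bool) → List Bool}

/-- `K` is a short sublist of the list `B` of models that covers every pair of strings lying in at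
least `2 ^ t` models of `B`. -/
def IsPairCover (a : (ℕ × ℕ × ℕ) × List (List Bool × List (List Bool)))
    (K : List (List Bool × List (List Bool))) : Prop :=
  K.length ≤ (2 * a.1.1 + 1) * 2 ^ (a.1.2.2 - a.1.2.1) ∧ (∀ q ∈ K, q ∈ a.2) ∧
    ∀ u ∈ a.2.flatMap Prod.snd, ∀ v ∈ a.2.flatMap Prod.snd,
      2 ^ a.1.2.1 ≤ (a.2.filter fun q => u ∈ q.2 ∧ v ∈ q.2).length → ∃ q ∈ K, u ∈ q.2 ∧ v ∈ q.2

/-- Decidability lets a cover be found by search. It rests on all quantifiers being bounded: `u` and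
`v` range only over the strings that occur in the models of the list. -/
theorem IsPairCover.primrecPred :
    PrimrecPred fun r : ((ℕ × ℕ × ℕ) × List (List Bool × List (List Bool))) ×
      List (List Bool × List (List Bool)) => IsPairCover r.1 r.2 := by
  have hboth : PrimrecRel fun (q : List Bool × List (List Bool)) (w : List Bool × List Bool) =>
      w.1 ∈ q.2 ∧ w.2 ∈ q.2 :=
    (Primrec.mem_list.comp (Primrec.fst.comp Primrec.snd) (Primrec.snd.comp Primrec.fst)).and
      (Primrec.mem_list.comp (Primrec.snd.comp Primrec.snd) (Primrec.snd.comp Primrec.fst))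
  have hex := PrimrecRel.exists_mem_list hboth
  have hfil := PrimrecRel.listFilter hboth
  have hflat : Primrec fun B : List (List Bool × List (List Bool)) => B.flatMap Prod.snd :=
    Primrec.list_flatMap Primrec.id (Primrec.snd.comp Primrec.snd).to₂
  have hpair : PrimrecRel fun (v : List Bool) (s : List Bool × ((ℕ × ℕ × ℕ) ×
      List (List Bool × List (List Bool))) × List (List Bool × List (List Bool))) =>
      2 ^ s.2.1.1.2.1 ≤ (s.2.1.2.filter fun q => s.1 ∈ q.2 ∧ v ∈ q.2).length →
        ∃ q ∈ s.2.2, s.1 ∈ q.2 ∧ v ∈ q.2 := by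
    have hw : Primrec fun o : List Bool × List Bool × ((ℕ × ℕ × ℕ) ×
        List (List Bool × List (List Bool))) × List (List Bool × List (List Bool)) =>
        (o.2.1, o.1) := (Primrec.fst.comp Primrec.snd).pair Primrec.fst
    have hB : Primrec fun o : List Bool × List Bool × ((ℕ × ℕ × ℕ) ×
        List (List Bool × List (List Bool))) × List (List Bool × List (List Bool)) =>
        o.2.2.1.2 := Primrec.snd.comp (Primrec.fst.comp (Primrec.snd.comp Primrec.snd))
    have hK : Primrec fun o : List Bool × List Bool × ((ℕ × ℕ × ℕ) ×
        List (List Bool × List (List Bool))) × List (List Bool × List (List Bool)) =>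
        o.2.2.2 := Primrec.snd.comp (Primrec.snd.comp Primrec.snd)
    have ht : Primrec fun o : List Bool × List Bool × ((ℕ × ℕ × ℕ) ×
        List (List Bool × List (List Bool))) × List (List Bool × List (List Bool)) =>
        2 ^ o.2.2.1.1.2.1 :=
      Primrec.nat_pow.comp (Primrec.const 2) (Primrec.fst.comp (Primrec.snd.comp (Primrec.fst.comp
        (Primrec.fst.comp (Primrec.snd.comp Primrec.snd)))))
    have h := (Primrec.nat_le.comp ht (Primrec.list_length.comp (hfil.comp hB hw))).not.or
      (hex.comp hK hw)
    exact h.of_eq fun o => imp_iff_not_or.symm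
  have hv := PrimrecRel.forall_mem_list hpair
  have hv' : PrimrecRel fun (u : List Bool) (s : ((ℕ × ℕ × ℕ) ×
      List (List Bool × List (List Bool))) × List (List Bool × List (List Bool))) =>
      ∀ v ∈ s.1.2.flatMap Prod.snd,
        2 ^ s.1.1.2.1 ≤ (s.1.2.filter fun q => u ∈ q.2 ∧ v ∈ q.2).length →
          ∃ q ∈ s.2, u ∈ q.2 ∧ v ∈ q.2 :=
    hv.comp (hflat.comp (Primrec.snd.comp (Primrec.fst.comp Primrec.snd))) Primrec.id
  have hu := PrimrecRel.forall_mem_list hv'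
  have hsub := PrimrecRel.forall_mem_list (R := fun (q : List Bool × List (List Bool)) B => q ∈ B)
    Primrec.mem_list
  have hn : Primrec fun r : ((ℕ × ℕ × ℕ) × List (List Bool × List (List Bool))) ×
      List (List Bool × List (List Bool)) => (2 * r.1.1.1 + 1) * 2 ^ (r.1.1.2.2 - r.1.1.2.1) := by
    have h0 : Primrec fun r : ((ℕ × ℕ × ℕ) × List (List Bool × List (List Bool))) ×
      List (List Bool × List (List Bool)) => r.1.1 := Primrec.fst.comp Primrec.fst
    have h1 := Primrec.snd.comp h0
    exact Primrec.nat_mul.comp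
      (Primrec.succ.comp (Primrec.nat_mul.comp (Primrec.const 2) (Primrec.fst.comp h0)))
      (Primrec.nat_pow.comp (Primrec.const 2)
        (Primrec.nat_sub.comp (Primrec.snd.comp h1) (Primrec.fst.comp h1)))
  have h1 := Primrec.nat_le.comp (Primrec.list_length.comp Primrec.snd) hn
  have h2 : PrimrecPred fun r : ((ℕ × ℕ × ℕ) × List (List Bool × List (List Bool))) ×
      List (List Bool × List (List Bool)) => ∀ q ∈ r.2, q ∈ r.1.2 :=
    hsub.comp Primrec.snd (Primrec.snd.comp Primrec.fst)
  have h3 := hu.comp (hflat.comp (Primrec.snd.comp Primrec.fst)) Primrec.id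
  exact h1.and (h2.and h3)

/-- Models `l` with code `z` of complexity at most `k`, consisting of at most `2 ^ i` strings of
length `n`; the triple `(n, k, i)` is the parameter. -/
def IsCodedModel (D : List Bool →. List Bool) (e : Finset (List Bool) → List Bool)
    (𝒜 : Set (Finset (List Bool))) (a : ℕ × ℕ × ℕ) (q : List Bool × List (List Bool)) : Prop :=
  (q.1 = e q.2.toFinset ∧ kolmogorovC D q.1 ≤ a.2.1) ∧ q.2.toFinset ∈ 𝒜 ∧
    q.2.length ≤ 2 ^ a.2.2 ∧ ∀ u ∈ q.2, u.length = a.1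

theorem IsOptimalLanguage.isCodedModel_re (hD : IsOptimalLanguage D) (he : IsSetEncoding e)
    {𝒜 : Set (Finset (List Bool))} (h𝒜 : IsDecidableFamily 𝒜) :
    REPred fun r : (ℕ × ℕ × ℕ) × (List Bool × List (List Bool)) =>
      IsCodedModel D e 𝒜 r.1 r.2 := by
  have hz : Computable fun r : (ℕ × ℕ × ℕ) × (List Bool × List (List Bool)) => r.2.1 :=
    Computable.fst.comp Computable.snd
  have hl : Primrec fun r : (ℕ × ℕ × ℕ) × (List Bool × List (List Bool)) => r.2.2 :=
    Primrec.snd.comp Primrec.snd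
  have h1 : REPred fun r : (ℕ × ℕ × ℕ) × (List Bool × List (List Bool)) =>
      r.2.1 = e r.2.2.toFinset := by
    have heq : ComputablePred fun w : List Bool × List Bool => w.1 = w.2 :=
      PrimrecPred.computablePred Primrec.eq
    have hp := hz.pair (he.2.comp hl.to_comp)
    have h := heq.to_re.comp hp
    exact h
  have hk : Computable fun r : (ℕ × ℕ × ℕ) × (List Bool × List (List Bool)) => r.1.2.1 :=
    (Primrec.fst.comp (Primrec.snd.comp Primrec.fst)).to_comp
  have h2 := hD.complexity_le_re.comp (hz.pair hk)
  have h3 := (ComputablePred.to_re h𝒜).comp hl.to_comp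
  have hall : PrimrecRel fun (l : List (List Bool)) (k : ℕ) => ∀ u ∈ l, u.length = k :=
    PrimrecRel.forall_mem_list (R := fun (u : List Bool) (k : ℕ) => u.length = k)
      (Primrec.eq.comp (Primrec.list_length.comp Primrec.fst) Primrec.snd)
  have hi : Primrec fun r : (ℕ × ℕ × ℕ) × (List Bool × List (List Bool)) => 2 ^ r.1.2.2 :=
    Primrec.nat_pow.comp (Primrec.const 2) (Primrec.snd.comp (Primrec.snd.comp Primrec.fst))
  have h4 := (Primrec.nat_le.comp (Primrec.list_length.comp hl) hi).computablePred.to_re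
  have h5 := (hall.comp hl (Primrec.fst.comp Primrec.fst)).computablePred.to_re
  exact (h1.and h2).and (h3.and (h4.and h5))

end ManyModels

/-! ### Codes of models that occur in covers of blocks -/

section ManyModels

variable {D : List Bool →. List Bool} {e : Finset (List Bool) → List Bool}

/-- `z` is the code of a model that occurs in the cover, chosen by `g`, of a block of the
enumeration `L`. -/
def IsCoverCode (L : ℕ × ℕ × ℕ → ℕ → List (List Bool × List (List Bool)))
    (g : (ℕ × ℕ × ℕ) × List (List Bool × List (List Bool)) →.
      List (List Bool × List (List Bool)))
    (a : (ℕ × ℕ × ℕ) × (ℕ × ℕ)) (z : List Bool) (q s : ℕ) : Prop :=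
  (q + 1) * 2 ^ a.2.2 ≤ (L a.1 s).length ∧
    ∃ K, K ∈ g ((a.1.1, a.2), listBlock (L a.1 s) (2 ^ a.2.2) q) ∧ z ∈ K.map Prod.fst

theorem IsCoverCode.re {L : ℕ × ℕ × ℕ → ℕ → List (List Bool × List (List Bool))}
    (hL : Computable₂ L)
    {g : (ℕ × ℕ × ℕ) × List (List Bool × List (List Bool)) →.
      List (List Bool × List (List Bool))} (hg : Partrec g) :
    REPred fun w : ((ℕ × ℕ × ℕ) × (ℕ × ℕ)) × List Bool =>
      ∃ r : ℕ × ℕ, IsCoverCode L g w.1 w.2 r.1 r.2 := by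
  refine REPred.exists (p := fun v : (((ℕ × ℕ × ℕ) × (ℕ × ℕ)) × List Bool) × (ℕ × ℕ) =>
    IsCoverCode L g v.1.1 v.1.2 v.2.1 v.2.2) ?_
  have hLv : Computable fun v : (((ℕ × ℕ × ℕ) × (ℕ × ℕ)) × List Bool) × (ℕ × ℕ) =>
      L v.1.1.1 v.2.2 :=
    hL.comp (Computable.fst.comp (Computable.fst.comp Computable.fst))
      (Computable.snd.comp Computable.snd)
  have hpow : Primrec fun v : (((ℕ × ℕ × ℕ) × (ℕ × ℕ)) × List Bool) × (ℕ × ℕ) =>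
      2 ^ v.1.1.2.2 :=
    Primrec.nat_pow.comp (Primrec.const 2)
      (Primrec.snd.comp (Primrec.snd.comp (Primrec.fst.comp Primrec.fst)))
  have hq : Primrec fun v : (((ℕ × ℕ × ℕ) × (ℕ × ℕ)) × List Bool) × (ℕ × ℕ) => v.2.1 :=
    Primrec.fst.comp Primrec.snd
  have hle : ComputablePred fun w : ℕ × ℕ => w.1 ≤ w.2 := PrimrecPred.computablePred Primrec.nat_le
  have h1 := hle.to_re.comp ((Primrec.nat_mul.comp (Primrec.succ.comp hq) hpow).to_comp.pair
    (Computable.list_length.comp hLv))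
  have hblock : Computable fun v : (((ℕ × ℕ × ℕ) × (ℕ × ℕ)) × List Bool) × (ℕ × ℕ) =>
      listBlock (L v.1.1.1 v.2.2) (2 ^ v.1.1.2.2) v.2.1 :=
    Primrec.list_take.to_comp.comp hpow.to_comp (Primrec.list_drop.to_comp.comp
      (Primrec.nat_mul.comp hq hpow).to_comp hLv)
  have hpar : Computable fun v : (((ℕ × ℕ × ℕ) × (ℕ × ℕ)) × List Bool) × (ℕ × ℕ) =>
      (((v.1.1.1.1, v.1.1.2), listBlock (L v.1.1.1 v.2.2) (2 ^ v.1.1.2.2) v.2.1) :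
        (ℕ × ℕ × ℕ) × List (List Bool × List (List Bool))) := by
    refine Computable.pair (Primrec.to_comp ?_) hblock
    have h : Primrec fun v : (((ℕ × ℕ × ℕ) × (ℕ × ℕ)) × List Bool) × (ℕ × ℕ) => v.1.1 :=
      Primrec.fst.comp Primrec.fst
    exact (Primrec.fst.comp (Primrec.fst.comp h)).pair (Primrec.snd.comp h)
  have h2 := (Partrec.mem_re hg).comp ((hpar.comp Computable.fst).pair
    (Computable.snd (β := List (List Bool × List (List Bool)))))
  have hzmem : PrimrecPred fun v : ((((ℕ × ℕ × ℕ) × (ℕ × ℕ)) × List Bool) × (ℕ × ℕ)) ×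
      List (List Bool × List (List Bool)) => v.1.1.2 ∈ v.2.map Prod.fst :=
    Primrec.mem_list.comp (Primrec.snd.comp (Primrec.fst.comp Primrec.fst))
      (Primrec.list_map_fst.comp Primrec.snd)
  have h3 := h2.and hzmem.computablePred.to_re
  exact h1.and h3.exists

/-- There are at most N / 2^τ full blocks. Two codes from the same block come from one and the same
cover, even if witnessed at different stages, because `g` is single-valued and full blocks do not
change. -/
theorem card_isCoverCode_le {L : ℕ × ℕ × ℕ → ℕ → List (List Bool × List (List Bool))}
    (hmono : ∀ a m n, m ≤ n → L a m <+: L a n)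
    {g : (ℕ × ℕ × ℕ) × List (List Bool × List (List Bool)) →.
      List (List Bool × List (List Bool))}
    (hg : ∀ a, ∀ K ∈ g a, IsPairCover a K) (a : (ℕ × ℕ × ℕ) × (ℕ × ℕ)) {N : ℕ}
    (hN : ∀ s, (L a.1 s).length ≤ N) (S : Finset (List Bool))
    (hS : ∀ z ∈ S, ∃ r : ℕ × ℕ, IsCoverCode L g a z r.1 r.2) :
    S.card ≤ N / 2 ^ a.2.2 * ((2 * a.1.1 + 1) * 2 ^ (a.2.2 - a.2.1)) := by
  classical
  choose! r hr using hS
  have hq : ∀ z ∈ S, (r z).1 ∈ Finset.range (N / 2 ^ a.2.2) := by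
    intro z hz
    rw [Finset.mem_range, Nat.lt_iff_add_one_le, Nat.le_div_iff_mul_le (by positivity)]
    exact (hr z hz).1.trans (hN _)
  have h := Finset.card_le_mul_card_image_of_maps_to hq
    ((2 * a.1.1 + 1) * 2 ^ (a.2.2 - a.2.1)) fun q _ => ?_
  · rwa [Finset.card_range, mul_comm] at h
  rcases (S.filter fun z => (r z).1 = q).eq_empty_or_nonempty with h0 | ⟨z₀, hz₀⟩
  · rw [h0]
    exact Nat.zero_le _
  obtain ⟨hz₀S, hz₀q⟩ := Finset.mem_filter.1 hz₀
  obtain ⟨hlen₀, K₀, hK₀, -⟩ := hr z₀ hz₀S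
  have hsub : (S.filter fun z => (r z).1 = q) ⊆ (K₀.map Prod.fst).toFinset := by
    intro z hz
    obtain ⟨hzS, hzq⟩ := Finset.mem_filter.1 hz
    obtain ⟨hlen, K, hK, hzK⟩ := hr z hzS
    rw [hz₀q] at hlen₀ hK₀
    rw [hzq] at hlen hK
    have hblock : listBlock (L a.1 (r z).2) (2 ^ a.2.2) q =
        listBlock (L a.1 (r z₀).2) (2 ^ a.2.2) q := by
      rcases le_total (r z).2 (r z₀).2 with h | h
      · exact listBlock_eq_of_prefix (hmono _ _ _ h) hlen
      · exact (listBlock_eq_of_prefix (hmono _ _ _ h) hlen₀).symm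
    rw [hblock] at hK
    rw [Part.mem_unique hK₀ hK]
    exact List.mem_toFinset.2 hzK
  refine (Finset.card_le_card hsub).trans ((List.toFinset_card_le _).trans ?_)
  rw [List.length_map]
  exact (hg _ _ hK₀).1

/-- The greedy cover is applied with pairs of n-bit strings as points, of which there are 4^n. -/
theorem exists_isPairCover {n t τ : ℕ} (htτ : t ≤ τ)
    (B : List (List Bool × List (List Bool))) (hB : B.length = 2 ^ τ) (hnodup : B.Nodup)
    (hn : ∀ q ∈ B, ∀ u ∈ q.2, u.length = n) : ∃ K, IsPairCover ((n, t, τ), B) K := by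
  classical
  let R : List Bool × List (List Bool) → List Bool × List Bool → Prop := fun q w =>
    w.1 ∈ q.2 ∧ w.2 ∈ q.2
  let P : Finset (List Bool × List Bool) := (bitStrings n ×ˢ bitStrings n).filter fun w =>
    2 ^ t ≤ (B.toFinset.filter fun q => R q w).card
  obtain ⟨K, hKB, hKr, hK⟩ := exists_cover B.toFinset P R (n := n) htτ
    ((List.toFinset_card_le B).trans hB.le) (by
      refine (Finset.card_filter_le _ _).trans ?_
      rw [Finset.card_product, card_bitStrings, ← mul_pow]
      norm_num)
    (fun w hw => by convert (Finset.mem_filter.1 hw).2)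
  have hflat : ∀ u ∈ B.flatMap Prod.snd, u ∈ bitStrings n := by
    intro u hu
    obtain ⟨q, hq, huq⟩ := List.mem_flatMap.1 hu
    exact mem_bitStrings.2 (hn q hq u huq)
  refine ⟨K.toList, by simpa using hKr, fun q hq => ?_, fun u hu v hv huv => ?_⟩
  · exact List.mem_toFinset.1 (hKB (Finset.mem_toList.1 hq))
  · obtain ⟨q, hq, hR⟩ := hK (u, v) (by
      refine Finset.mem_filter.2 ⟨Finset.mk_mem_product (hflat u hu) (hflat v hv), ?_⟩
      refine huv.trans (le_of_eq ?_)
      rw [← List.toFinset_card_of_nodup (hnodup.filter _), List.toFinset_filter]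
      simp [R])
    exact ⟨q, Finset.mem_toList.2 hq, hR⟩

end ManyModels

/-! ### Numerical bounds and the simpler model -/

section ManyModels

variable {D : List Bool →. List Bool} {e : Finset (List Bool) → List Bool}

theorem pair_add_one_le_pow {a b p X : ℕ} (hX : 2 ≤ X) (ha : a + 1 ≤ X ^ p) (hb : b + 1 ≤ X ^ p) :
    Nat.pair a b + 1 ≤ X ^ (2 * p + 2) := by
  have h : a + b + 1 ≤ X ^ (p + 1) := by
    rw [pow_succ]
    nlinarith [Nat.mul_le_mul_left (X ^ p) hX]
  calc Nat.pair a b + 1 ≤ (a + b + 1) ^ 2 := Nat.pair_add_one_le a b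
    _ ≤ (X ^ (p + 1)) ^ 2 := Nat.pow_le_pow_left h 2
    _ = _ := by rw [← pow_mul]; congr 1; ring

/-- The five parameters cost only a polynomial factor. Each pairing turns the exponent p into 2p +
2, along 1, 4, 10, 22. -/
theorem encode_parameters_add_one_le {n k i t τ X : ℕ} (hX : 2 ≤ X) (hn : n + 1 ≤ X)
    (hk : k + 1 ≤ X) (hi : i + 1 ≤ X) (ht : t + 1 ≤ X) (hτ : τ + 1 ≤ X) :
    Encodable.encode (((n, k, i), (t, τ)) : (ℕ × ℕ × ℕ) × (ℕ × ℕ)) + 1 ≤ X ^ 22 := by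
  have h1 : Nat.pair k i + 1 ≤ X ^ 4 :=
    pair_add_one_le_pow hX (p := 1) (by simpa using hk) (by simpa using hi)
  have h2 : Nat.pair n (Nat.pair k i) + 1 ≤ X ^ 10 :=
    pair_add_one_le_pow hX (hn.trans (Nat.le_self_pow (by norm_num) X)) h1
  have h3 : Nat.pair t τ + 1 ≤ X ^ 4 :=
    pair_add_one_le_pow hX (p := 1) (by simpa using ht) (by simpa using hτ)
  exact pair_add_one_le_pow hX h2 (h3.trans (Nat.pow_le_pow_right (by omega) (by norm_num)))

/-- The numerical part of the bound on the complexity of the model found in a cover. -/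
theorem mul_le_of_cover_bounds {a T c E n k i t τ : ℕ} (htτ : t ≤ τ)
    (hE : E ≤ (n + k + i + 2) ^ 22)
    (ha : a ≤ c * E ^ 2 * (2 ^ (k + 1) / 2 ^ τ * ((2 * n + 1) * 2 ^ (τ - t))))
    (hT : T ≤ (k + 2) * 2 ^ (t + 1)) : a * T ≤ (n + k + i + 2) ^ (c + 49) * 2 ^ k := by
  have hX : 2 ≤ n + k + i + 2 := by omega
  have hc : c ≤ (n + k + i + 2) ^ c := le_add_two_pow c (n + k + i)
  have hn : 2 * n + 1 ≤ 2 * (n + k + i + 2) := by omega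
  have hk : k + 2 ≤ n + k + i + 2 := by omega
  have hdiv : 2 ^ (k + 1) / 2 ^ τ * (2 ^ (τ - t) * 2 ^ t) ≤ 2 * 2 ^ k := by
    rw [← pow_add, Nat.sub_add_cancel htτ, ← pow_succ']
    exact Nat.div_mul_le_self _ _
  rw [pow_succ] at hT
  generalize n + k + i + 2 = X at *
  generalize 2 ^ (k + 1) / 2 ^ τ = d at *
  generalize 2 ^ (τ - t) = u at *
  generalize 2 ^ t = v at *
  generalize 2 ^ k = w at *
  calc a * T ≤ c * E ^ 2 * (d * ((2 * n + 1) * u)) * ((k + 2) * (v * 2)) := Nat.mul_le_mul ha hT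
    _ = c * E ^ 2 * (d * (u * v)) * ((2 * n + 1) * (2 * (k + 2))) := by ring
    _ ≤ X ^ c * (X ^ 22) ^ 2 * (2 * w) * ((2 * X) * (2 * X)) := by gcongr
    _ = X ^ (c + 46) * w * 2 ^ 3 := by ring
    _ ≤ X ^ (c + 46) * w * X ^ 3 := Nat.mul_le_mul_left _ (Nat.pow_le_pow_left hX 3)
    _ = X ^ (c + 49) * w := by ring

/-- Some block of a list of codes contains more than its share of the elements with a given
property; its length and its number of such elements are described by powers of two. -/
theorem exists_listBlock_two_pow_le {ι : Type*} (p : ι → Bool) {k T : ℕ} (l : List ι)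
    (hl : l.length ≤ 2 ^ (k + 1)) (hT0 : 0 < T) (hT : T ≤ l.countP p) :
    ∃ t τ q, t ≤ τ ∧ τ ≤ k + 1 ∧ (q + 1) * 2 ^ τ ≤ l.length ∧
      2 ^ t ≤ (listBlock l (2 ^ τ) q).countP p ∧ T ≤ (k + 2) * 2 ^ (t + 1) := by
  -- Q = (T-1)/(k+2) is the largest threshold with (k+2) · Q < T. The number of scales is k + 2
  -- since the list length must be strictly below the power of two.
  have h1 : (k + 2) * ((T - 1) / (k + 2)) ≤ T - 1 := Nat.mul_div_le _ _
  have h2 : T - 1 < (k + 2) * ((T - 1) / (k + 2) + 1) := Nat.lt_mul_div_succ _ (by omega)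
  obtain ⟨τ, hτ, q, hq, hQ⟩ := exists_listBlock_lt_countP p ((T - 1) / (k + 2)) (k + 2) l
    (hl.trans_lt (Nat.pow_lt_pow_right (by norm_num) (by omega))) (by omega)
  generalize (T - 1) / (k + 2) = Q at *
  have ht1 : 2 ^ Nat.log 2 (Q + 1) ≤ Q + 1 := Nat.pow_log_le_self 2 (by omega)
  have ht2 : Q + 1 < 2 ^ (Nat.log 2 (Q + 1) + 1) := Nat.lt_pow_succ_log_self (by norm_num) _
  have hle : 2 ^ Nat.log 2 (Q + 1) ≤ (listBlock l (2 ^ τ) q).countP p := ht1.trans hQ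
  refine ⟨Nat.log 2 (Q + 1), τ, q, ?_, by omega, hq, hle, ?_⟩
  · have h := hle.trans (List.countP_le_length.trans (length_listBlock hq).le)
    exact (Nat.pow_le_pow_iff_right (by norm_num)).1 h
  · have := Nat.mul_le_mul_left (k + 2) ht2.le
    omega

/-- A finite set of models is enumerated by some stage. -/
theorem exists_stage_card_le_countP (he : Function.Injective e) {𝒜 : Set (Finset (List Bool))}
    {L : ℕ × ℕ × ℕ → ℕ → List (List Bool × List (List Bool))}
    (hmono : ∀ a m n, m ≤ n → L a m <+: L a n)
    (hLM : ∀ a n, ∀ q ∈ L a n, IsCodedModel D e 𝒜 a q)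
    (hML : ∀ a q, IsCodedModel D e 𝒜 a q → ∃ n, q.1 ∈ (L a n).map Prod.fst)
    {n k i : ℕ} {x y : List Bool} {T : Finset (Finset (List Bool))}
    (hT : ∀ A ∈ T, A ∈ 𝒜 ∧ A ⊆ bitStrings n ∧ kolmogorovC D (e A) ≤ k ∧ A.card ≤ 2 ^ i ∧
      x ∈ A ∧ y ∈ A) :
    ∃ s, T.card ≤ (L (n, k, i) s).countP fun q => x ∈ q.2 ∧ y ∈ q.2 := by
  classical
  obtain ⟨s, hs⟩ : ∃ s, ∀ A ∈ T, e A ∈ (L (n, k, i) s).map Prod.fst := by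
    have hex : ∀ A ∈ T, ∃ s, e A ∈ (L (n, k, i) s).map Prod.fst := by
      intro A hA
      obtain ⟨h1, h2, h3, h4, -⟩ := hT A hA
      refine hML (n, k, i) (e A, A.toList) ⟨⟨by simp, h3⟩, by simpa using h1, by simpa using h4, ?_⟩
      exact fun u hu => mem_bitStrings.1 (h2 (Finset.mem_toList.1 hu))
    choose! st hst using hex
    refine ⟨T.sup st, fun A hA => ?_⟩
    exact ((hmono (n, k, i) _ _ (Finset.le_sup hA)).map Prod.fst).subset (hst A hA)
  refine ⟨s, ?_⟩
  have hsub : T.image e ⊆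
      (((L (n, k, i) s).filter fun q => x ∈ q.2 ∧ y ∈ q.2).map Prod.fst).toFinset := by
    intro z hz
    obtain ⟨A, hA, rfl⟩ := Finset.mem_image.1 hz
    obtain ⟨q, hq, hqA⟩ := List.mem_map.1 (hs A hA)
    -- The enumeration may have recorded another list of elements for the same code; injectivity of
    -- the encoding identifies the sets.
    have hA' : A = q.2.toFinset := he (hqA.symm.trans (hLM _ s q hq).1.1)
    obtain ⟨-, -, -, -, hx, hy⟩ := hT A hA
    rw [hA', List.mem_toFinset] at hx hy
    exact List.mem_toFinset.2 (List.mem_map.2 ⟨q, List.mem_filter.2 ⟨hq, by simp [hx, hy]⟩, hqA⟩)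
  have h := Finset.card_le_card hsub
  rw [Finset.card_image_of_injective T he] at h
  refine h.trans ((List.toFinset_card_le _).trans ?_)
  rw [List.length_map, List.countP_eq_length_filter]

/-- If two strings lie together in many models of complexity at most `k` and size at most `2 ^ i`,
then they lie together in a model of that size whose complexity is smaller than `k` by almost
the logarithm of the number of models. -/
theorem IsOptimalLanguage.exists_simpler_model (hD : IsOptimalLanguage D) (he : IsSetEncoding e)
    {𝒜 : Set (Finset (List Bool))} (h𝒜 : IsDecidableFamily 𝒜) :
    ∃ c : ℕ, ∀ (n k i : ℕ) (x y : List Bool) (T : Finset (Finset (List Bool))), T.Nonempty →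
      (∀ A ∈ T, A ∈ 𝒜 ∧ A ⊆ bitStrings n ∧ kolmogorovC D (e A) ≤ k ∧ A.card ≤ 2 ^ i ∧
        x ∈ A ∧ y ∈ A) →
      ∃ A ∈ 𝒜, A ⊆ bitStrings n ∧ x ∈ A ∧ y ∈ A ∧ A.card ≤ 2 ^ i ∧
        2 ^ kolmogorovC D (e A) * T.card ≤ (n + k + i + 2) ^ c * 2 ^ k := by
  classical
  obtain ⟨L, hL, hmono, hnodup, hLM, hML⟩ := (hD.isCodedModel_re he h𝒜).exists_enumeration
  obtain ⟨g, hg, hgK, hgdom⟩ := IsPairCover.primrecPred.computablePred.to_re.exists_partrec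
  obtain ⟨c, hc⟩ := hD.two_pow_complexity_le (IsCoverCode.re hL hg)
  refine ⟨c + 49, fun n k i x y T hT0 hT => ?_⟩
  have hlenL : ∀ s, (L (n, k, i) s).length ≤ 2 ^ (k + 1) := by
    intro s
    have h := hD.card_complexity_le ((L (n, k, i) s).map Prod.fst).toFinset k fun z hz => by
      obtain ⟨q, hq, rfl⟩ := List.mem_map.1 (List.mem_toFinset.1 hz)
      exact (hLM _ s q hq).1.2
    rwa [List.toFinset_card_of_nodup (hnodup _ s), List.length_map] at h
  obtain ⟨s, hcount⟩ := exists_stage_card_le_countP he.1 hmono hLM hML hT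
  obtain ⟨t, τ, q, htτ, hτ, hqlen, hheavy, hTle⟩ := exists_listBlock_two_pow_le _ _ (hlenL s)
    (Finset.card_pos.2 hT0) hcount
  rw [List.countP_eq_length_filter] at hheavy
  have hBlen := length_listBlock hqlen
  have hBl : (listBlock (L (n, k, i) s) (2 ^ τ) q).Sublist (L (n, k, i) s) :=
    (List.take_sublist _ _).trans (List.drop_sublist _ _)
  have hBnodup := (List.Nodup.of_map _ (hnodup (n, k, i) s)).sublist hBl
  obtain ⟨K, hK⟩ : ∃ K, K ∈ g ((n, t, τ), listBlock (L (n, k, i) s) (2 ^ τ) q) := by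
    rw [← Part.dom_iff_mem, hgdom]
    exact exists_isPairCover htτ _ hBlen hBnodup fun q hq =>
      (hLM _ s q (hBl.subset hq)).2.2.2
  have hcov := hgK _ _ hK
  obtain ⟨r, hrK, hxr, hyr⟩ : ∃ r ∈ K, x ∈ r.2 ∧ y ∈ r.2 := by
    obtain ⟨p, hp⟩ := List.exists_mem_of_length_pos (lt_of_lt_of_le (by positivity) hheavy)
    obtain ⟨hpB, hpxy⟩ := List.mem_filter.1 hp
    have hpxy' : x ∈ p.2 ∧ y ∈ p.2 := by simpa using hpxy
    exact hcov.2.2 x (List.mem_flatMap.2 ⟨p, hpB, hpxy'.1⟩) y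
      (List.mem_flatMap.2 ⟨p, hpB, hpxy'.2⟩) hheavy
  obtain ⟨⟨hrz, -⟩, hr𝒜, hrlen, hrn⟩ := hLM _ s r (hBl.subset (hcov.2.1 r hrK))
  refine ⟨r.2.toFinset, hr𝒜, fun u hu => mem_bitStrings.2 (hrn u (List.mem_toFinset.1 hu)),
    List.mem_toFinset.2 hxr, List.mem_toFinset.2 hyr, (List.toFinset_card_le _).trans hrlen, ?_⟩
  rw [← hrz]
  -- The model is described by (n, k, i, t, τ) and its position among all cover codes, of which
  -- there are about (2n+1) · 2^(k+1-t).
  have hbound := hc ((n, k, i), (t, τ)) r.1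
    (2 ^ (k + 1) / 2 ^ τ * ((2 * n + 1) * 2 ^ (τ - t)))
    ⟨(q, s), hqlen, K, hK, List.mem_map_of_mem hrK⟩
    fun S hS => card_isCoverCode_le hmono (fun a K hK => hgK a K hK) ((n, k, i), (t, τ)) hlenL S hS
  exact mul_le_of_cover_bounds htτ (encode_parameters_add_one_le (by omega) (by omega) (by omega)
    (by omega) (by omega) (by omega)) hbound hTle

end ManyModels

/-! ### Weights of models -/

section Weights

variable {D : List Bool →. List Bool} {m : List Bool → ℝ} {e : Finset (List Bool) → List Bool}
  {𝒜 : Set (Finset (List Bool))}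

open Classical in
/-- The numerator of `predictionProbability`. -/
noncomputable def predictionWeight (D : List Bool →. List Bool) (m : List Bool → ℝ)
    (e : Finset (List Bool) → List Bool) (𝒜 : Set (Finset (List Bool))) (x y : List Bool) : ℝ :=
  ∑ A ∈ (admissibleModels D e 𝒜 x).filter (fun A => y ∈ A), m (e A) / (A.card : ℝ)

theorem mem_admissibleModels {x : List Bool} {A : Finset (List Bool)} :
    A ∈ admissibleModels D e 𝒜 x ↔
      A ⊆ bitStrings x.length ∧ A ∈ 𝒜 ∧ kolmogorovC D (e A) ≤ 4 * x.length ∧ x ∈ A := by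
  classical
  rw [admissibleModels, Finset.mem_filter, Finset.mem_powerset]

/-- Every admissible model contains `x`, so the denominator is the numerator at y = x, and upper
bounds for one apply to both. -/
theorem predictionProbability_eq (x y : List Bool) : predictionProbability D m e 𝒜 x y =
    predictionWeight D m e 𝒜 x y / predictionWeight D m e 𝒜 x x := by
  rw [predictionProbability, predictionWeight, predictionWeight]
  congr 1
  rw [Finset.filter_true_of_mem fun _ hA => (mem_admissibleModels.1 hA).2.2.2]

theorem predictionWeight_nonneg (hm : ∀ z, 0 ≤ m z) (x y : List Bool) :
    0 ≤ predictionWeight D m e 𝒜 x y :=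
  Finset.sum_nonneg fun _ _ => div_nonneg (hm _) (Nat.cast_nonneg _)

theorem predictionWeight_le_self (hm : ∀ z, 0 ≤ m z) (x y : List Bool) :
    predictionWeight D m e 𝒜 x y ≤ predictionWeight D m e 𝒜 x x := by
  refine Finset.sum_le_sum_of_subset_of_nonneg (fun A hA => ?_)
    fun A _ _ => div_nonneg (hm _) (Nat.cast_nonneg _)
  have hA' := (Finset.mem_filter.1 hA).1
  exact Finset.mem_filter.2 ⟨hA', (mem_admissibleModels.1 hA').2.2.2⟩

theorem exists_model_of_predictionWeight_pos {x y : List Bool}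
    (h : 0 < predictionWeight D m e 𝒜 x y) :
    ∃ A ∈ admissibleModels D e 𝒜 x, y ∈ A := by
  obtain ⟨A, hA, -⟩ := Finset.exists_ne_zero_of_sum_ne_zero h.ne'
  exact ⟨A, (Finset.mem_filter.1 hA).1, (Finset.mem_filter.1 hA).2⟩

/-- The coefficient 6 comes from n + k + i with k ≤ 4n and i ≤ n. -/
theorem mul_add_two_le_pow (n : ℕ) : 6 * n + 2 ≤ (n + 2) ^ 4 := by
  calc 6 * n + 2 ≤ 2 ^ 3 * (n + 2) := by omega
    _ ≤ (n + 2) ^ 3 * (n + 2) := Nat.mul_le_mul_right _ (Nat.pow_le_pow_left (by omega) 3)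
    _ = (n + 2) ^ 4 := by ring

theorem two_pow_clog_le {a : ℕ} (ha : 1 ≤ a) : 2 ^ Nat.clog 2 a ≤ 2 * a := by
  rcases ha.eq_or_lt with rfl | h
  · simp
  · have hpos : 0 < Nat.clog 2 a := Nat.clog_pos (by norm_num) h
    have := Nat.pow_pred_clog_lt_self (b := 2) (by norm_num) h
    calc 2 ^ Nat.clog 2 a = 2 * 2 ^ (Nat.clog 2 a).pred := by
          rw [← pow_succ']
          congr 1
          rw [Nat.pred_eq_sub_one]
          omega
      _ ≤ 2 * a := by omega

/-- The weight of an admissible model is at least `2⁻ᶜ⁽ᴬ⁾ / |A|` up to a polynomial factor. -/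
theorem IsAPrioriProbability.one_le_mul_predictionWeight (hm : IsAPrioriProbability m)
    (hD : IsOptimalLanguage D) :
    ∃ c : ℕ, ∀ (x y : List Bool), ∀ A ∈ admissibleModels D e 𝒜 x, y ∈ A →
      1 ≤ ((x.length : ℝ) + 2) ^ c * (2 ^ kolmogorovC D (e A) * A.card) *
        predictionWeight D m e 𝒜 x y := by
  obtain ⟨c, hc⟩ := hm.one_le_mul hD
  refine ⟨4 * c, fun x y A hA hy => ?_⟩
  obtain ⟨-, -, hC, -⟩ := mem_admissibleModels.1 hA
  have hcard : (0 : ℝ) < A.card := by exact_mod_cast Finset.card_pos.2 ⟨y, hy⟩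
  have hterm : m (e A) / (A.card : ℝ) ≤ predictionWeight D m e 𝒜 x y :=
    Finset.single_le_sum (f := fun A => m (e A) / (A.card : ℝ))
      (fun A _ => div_nonneg (hm.1.nonneg _) (Nat.cast_nonneg _)) (Finset.mem_filter.2 ⟨hA, hy⟩)
  have hpoly : ((kolmogorovC D (e A) : ℝ) + 2) ≤ ((x.length : ℝ) + 2) ^ 4 := by
    have h := mul_add_two_le_pow x.length
    have : kolmogorovC D (e A) + 2 ≤ (x.length + 2) ^ 4 := by omega
    exact_mod_cast this
  calc (1 : ℝ) ≤ ((kolmogorovC D (e A) : ℝ) + 2) ^ c * 2 ^ kolmogorovC D (e A) * m (e A) :=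
        hc (e A)
    _ ≤ (((x.length : ℝ) + 2) ^ 4) ^ c * 2 ^ kolmogorovC D (e A) * m (e A) := by
        have := hm.1.nonneg (e A)
        gcongr
    _ = ((x.length : ℝ) + 2) ^ (4 * c) * (2 ^ kolmogorovC D (e A) * A.card) *
          (m (e A) / A.card) := by
        rw [pow_mul]
        field_simp
    _ ≤ _ := by gcongr

/-- The total weight of the models of a given complexity and size is dominated by one of them. -/
theorem IsAPrioriProbability.exists_sum_le (hm : IsAPrioriProbability m)
    (hD : IsOptimalLanguage D) (he : IsSetEncoding e) (h𝒜 : IsDecidableFamily 𝒜) :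
    ∃ c : ℕ, ∀ (n k i : ℕ) (x y : List Bool) (T : Finset (Finset (List Bool))), T.Nonempty →
      k ≤ 4 * n → i ≤ n →
      (∀ A ∈ T, A ∈ 𝒜 ∧ A ⊆ bitStrings n ∧ x ∈ A ∧ y ∈ A ∧ kolmogorovC D (e A) = k ∧
        Nat.clog 2 A.card = i) →
      ∃ A ∈ 𝒜, A ⊆ bitStrings n ∧ x ∈ A ∧ y ∈ A ∧
        ∑ B ∈ T, m (e B) / (B.card : ℝ) ≤
          ((n : ℝ) + 2) ^ c * (1 / (2 ^ kolmogorovC D (e A) * A.card)) := by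
  obtain ⟨c₁, hc₁⟩ := hm.mul_two_pow_le hD
  obtain ⟨c₂, hc₂⟩ := hD.exists_simpler_model he h𝒜
  refine ⟨4 * c₁ + 4 * c₂ + 1, fun n k i x y T hT0 hk hi hT => ?_⟩
  obtain ⟨A, hA, hAn, hx, hy, hAi, hAC⟩ := hc₂ n k i x y T hT0 fun B hB => by
    obtain ⟨h1, h2, h3, h4, h5, h6⟩ := hT B hB
    exact ⟨h1, h2, h5.le, h6 ▸ Nat.le_pow_clog (by norm_num) _, h3, h4⟩
  refine ⟨A, hA, hAn, hx, hy, ?_⟩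
  have hcard : (0 : ℝ) < A.card := by exact_mod_cast Finset.card_pos.2 ⟨y, hy⟩
  have hX : (2 : ℝ) ≤ (n : ℝ) + 2 := by linarith [(n.cast_nonneg : (0 : ℝ) ≤ n)]
  have h6 := mul_add_two_le_pow n
  have hpoly₁ : (k : ℝ) + 2 ≤ ((n : ℝ) + 2) ^ 4 := by
    have : k + 2 ≤ (n + 2) ^ 4 := by omega
    exact_mod_cast this
  have hpoly₂ : (n : ℝ) + k + i + 2 ≤ ((n : ℝ) + 2) ^ 4 := by
    have : n + k + i + 2 ≤ (n + 2) ^ 4 := by omega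
    exact_mod_cast this
  have hAC' : (2 : ℝ) ^ kolmogorovC D (e A) * T.card ≤ (((n : ℝ) + 2) ^ 4) ^ c₂ * 2 ^ k := by
    calc (2 : ℝ) ^ kolmogorovC D (e A) * T.card ≤ ((n : ℝ) + k + i + 2) ^ c₂ * 2 ^ k := by
          exact_mod_cast hAC
      _ ≤ _ := by gcongr
  have hAi' : (A.card : ℝ) ≤ 2 ^ i := by exact_mod_cast hAi
  have hterm : ∀ B ∈ T, m (e B) / (B.card : ℝ) ≤
      (((n : ℝ) + 2) ^ 4) ^ c₁ / 2 ^ k * (2 / 2 ^ i) := by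
    intro B hB
    obtain ⟨-, -, hxB, -, hBk, hBi⟩ := hT B hB
    have hB1 : 1 ≤ B.card := Finset.card_pos.2 ⟨x, hxB⟩
    have hB0 : (0 : ℝ) < B.card := by exact_mod_cast hB1
    have h1 : m (e B) ≤ (((n : ℝ) + 2) ^ 4) ^ c₁ / 2 ^ k := by
      rw [le_div_iff₀ (by positivity)]
      have h := hc₁ (e B)
      rw [hBk] at h
      exact h.trans (by gcongr)
    have h2 : 1 / (B.card : ℝ) ≤ 2 / 2 ^ i := by
      rw [div_le_div_iff₀ hB0 (by positivity), one_mul]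
      have h := two_pow_clog_le hB1
      rw [hBi] at h
      exact_mod_cast h
    rw [div_eq_mul_one_div]
    exact mul_le_mul h1 h2 (by positivity) (by positivity)
  have hsum := Finset.sum_le_card_nsmul T _ _ hterm
  rw [nsmul_eq_mul] at hsum
  refine hsum.trans ?_
  rw [mul_one_div, le_div_iff₀ (by positivity)]
  calc (T.card : ℝ) * ((((n : ℝ) + 2) ^ 4) ^ c₁ / 2 ^ k * (2 / 2 ^ i)) *
        (2 ^ kolmogorovC D (e A) * A.card)
      = (((n : ℝ) + 2) ^ 4) ^ c₁ * 2 * (2 ^ kolmogorovC D (e A) * T.card) * A.card *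
          (1 / (2 ^ k * 2 ^ i)) := by
        field_simp
    _ ≤ (((n : ℝ) + 2) ^ 4) ^ c₁ * ((n : ℝ) + 2) * ((((n : ℝ) + 2) ^ 4) ^ c₂ * 2 ^ k) * 2 ^ i *
          (1 / (2 ^ k * 2 ^ i)) := by gcongr
    _ = ((n : ℝ) + 2) ^ (4 * c₁ + 4 * c₂ + 1) := by
        rw [pow_succ _ (4 * c₁ + 4 * c₂), pow_add _ (4 * c₁), pow_mul, pow_mul]
        field_simp

/-- The total weight of the admissible models that contain `x` and `y` is dominated by one model
that contains them. -/
theorem IsAPrioriProbability.exists_predictionWeight_le (hm : IsAPrioriProbability m)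
    (hD : IsOptimalLanguage D) (he : IsSetEncoding e) (h𝒜 : IsDecidableFamily 𝒜) :
    ∃ c : ℕ, ∀ x y : List Bool, 0 < predictionWeight D m e 𝒜 x y →
      ∃ A ∈ 𝒜, A ⊆ bitStrings x.length ∧ x ∈ A ∧ y ∈ A ∧
        predictionWeight D m e 𝒜 x y ≤
          ((x.length : ℝ) + 2) ^ c * (1 / (2 ^ kolmogorovC D (e A) * A.card)) := by
  classical
  obtain ⟨c, hc⟩ := hm.exists_sum_le hD he h𝒜
  refine ⟨c + 5, fun x y hpos => ?_⟩
  set n := x.length with hn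
  -- No complexity bound is imposed here: the simpler models supplied by `hc` come without one.
  let cand := (bitStrings n).powerset.filter fun A => A ∈ 𝒜 ∧ x ∈ A ∧ y ∈ A
  have hcand : ∀ A, A ∈ cand ↔ A ⊆ bitStrings n ∧ A ∈ 𝒜 ∧ x ∈ A ∧ y ∈ A := fun A => by
    rw [Finset.mem_filter, Finset.mem_powerset]
  obtain ⟨A₀, hA₀, hyA₀⟩ := exists_model_of_predictionWeight_pos hpos
  obtain ⟨h1, h2, -, h4⟩ := mem_admissibleModels.1 hA₀
  obtain ⟨A, hA, hmax⟩ := Finset.exists_max_image cand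
    (fun A => (1 : ℝ) / (2 ^ kolmogorovC D (e A) * A.card)) ⟨A₀, (hcand A₀).2 ⟨h1, h2, h4, hyA₀⟩⟩
  obtain ⟨hAn, hA𝒜, hx, hy⟩ := (hcand A).1 hA
  refine ⟨A, hA𝒜, hAn, hx, hy, ?_⟩
  set v := (1 : ℝ) / (2 ^ kolmogorovC D (e A) * A.card) with hv
  have hv0 : 0 ≤ v := by positivity
  have hmaps : ∀ B ∈ (admissibleModels D e 𝒜 x).filter (fun A => y ∈ A),
      (kolmogorovC D (e B), Nat.clog 2 B.card) ∈
        Finset.range (4 * n + 1) ×ˢ Finset.range (n + 1) := by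
    intro B hB
    obtain ⟨hBn, -, hBC, -⟩ := mem_admissibleModels.1 (Finset.mem_filter.1 hB).1
    refine Finset.mk_mem_product (Finset.mem_range.2 (by omega))
      (Finset.mem_range.2 (Nat.lt_succ_of_le ?_))
    refine Nat.clog_le_of_le_pow ?_
    rw [← card_bitStrings]
    exact Finset.card_le_card hBn
  rw [predictionWeight, ← Finset.sum_fiberwise_of_maps_to hmaps]
  have hfiber : ∀ w ∈ Finset.range (4 * n + 1) ×ˢ Finset.range (n + 1),
      ∑ B ∈ (admissibleModels D e 𝒜 x).filter (fun A => y ∈ A) with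
        (kolmogorovC D (e B), Nat.clog 2 B.card) = w, m (e B) / (B.card : ℝ) ≤
      ((n : ℝ) + 2) ^ c * v := by
    rintro ⟨k, i⟩ hw
    obtain ⟨hk, hi⟩ := Finset.mem_product.1 hw
    rw [Finset.mem_range] at hk hi
    rcases Finset.eq_empty_or_nonempty
      (((admissibleModels D e 𝒜 x).filter (fun A => y ∈ A)).filter fun B =>
        (kolmogorovC D (e B), Nat.clog 2 B.card) = (k, i)) with h0 | hne
    · rw [h0, Finset.sum_empty]
      positivity
    · obtain ⟨B, hB, hBn, hxB, hyB, hle⟩ := hc n k i x y _ hne (by omega) (by omega)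
        fun B hB => by
          obtain ⟨hB1, hB2⟩ := Finset.mem_filter.1 hB
          obtain ⟨hB3, hB4⟩ := Finset.mem_filter.1 hB1
          obtain ⟨h1, h2, h3, h4⟩ := mem_admissibleModels.1 hB3
          exact ⟨h2, h1, h4, hB4, congrArg Prod.fst hB2, congrArg Prod.snd hB2⟩
      exact hle.trans (mul_le_mul_of_nonneg_left
        (hmax B ((hcand B).2 ⟨hBn, hB, hxB, hyB⟩)) (by positivity))
  refine (Finset.sum_le_card_nsmul _ _ _ hfiber).trans ?_
  rw [Finset.card_product, Finset.card_range, Finset.card_range, nsmul_eq_mul]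
  have hpoly : (((4 * n + 1) * (n + 1) : ℕ) : ℝ) ≤ ((n : ℝ) + 2) ^ 5 := by
    have h6 := mul_add_two_le_pow n
    have : (4 * n + 1) * (n + 1) ≤ (n + 2) ^ 5 := by
      rw [pow_succ]
      exact Nat.mul_le_mul (by omega) (by omega)
    exact_mod_cast this
  calc (((4 * n + 1) * (n + 1) : ℕ) : ℝ) * (((n : ℝ) + 2) ^ c * v)
      ≤ ((n : ℝ) + 2) ^ 5 * (((n : ℝ) + 2) ^ c * v) := by gcongr
    _ = ((n : ℝ) + 2) ^ (c + 5) * v := by ring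

/-- The total weight of the admissible models that contain `x` is at most `2⁻ᶜ⁽ˣ⁾` up to a
polynomial factor. -/
theorem IsAPrioriProbability.predictionWeight_self_le (hm : IsAPrioriProbability m)
    (hD : IsOptimalLanguage D) (he : IsSetEncoding e) (h𝒜 : IsDecidableFamily 𝒜) :
    ∃ c : ℕ, ∀ x : List Bool, predictionWeight D m e 𝒜 x x * 2 ^ kolmogorovC D x ≤
      ((x.length : ℝ) + 2) ^ c := by
  obtain ⟨c₁, hc₁⟩ := hm.exists_predictionWeight_le hD he h𝒜
  obtain ⟨c₂, hc₂⟩ := hD.two_pow_complexity_le_of_mem he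
  obtain ⟨c₃, hc₃⟩ := hD.complexity_le_length
  refine ⟨c₁ + (4 * c₂ + 1 + c₃), fun x => ?_⟩
  rcases (predictionWeight_nonneg hm.1.nonneg x x).eq_or_lt with h0 | hpos
  · rw [← h0, zero_mul]
    positivity
  obtain ⟨A, -, hAn, hx, -, hle⟩ := hc₁ x x hpos
  have hX : (2 : ℝ) ≤ (x.length : ℝ) + 2 := by
    linarith [(x.length.cast_nonneg : (0 : ℝ) ≤ x.length)]
  have hA1 : 1 ≤ A.card := Finset.card_pos.2 ⟨x, hx⟩
  have hA0 : (0 : ℝ) < A.card := by exact_mod_cast hA1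
  have hkey : (2 : ℝ) ^ kolmogorovC D x ≤
      ((x.length : ℝ) + 2) ^ (4 * c₂ + 1 + c₃) * (2 ^ kolmogorovC D (e A) * A.card) := by
    rcases le_or_gt (kolmogorovC D (e A)) (4 * x.length) with hC | hC
    · have hi : Nat.clog 2 A.card ≤ x.length := by
        refine Nat.clog_le_of_le_pow ?_
        rw [← card_bitStrings]
        exact Finset.card_le_card hAn
      have h := hc₂ A x _ (Nat.clog 2 A.card) hx le_rfl (Nat.le_pow_clog (by norm_num) _)
      have h6 := mul_add_two_le_pow x.length
      have h' : 2 ^ kolmogorovC D x ≤ ((x.length + 2) ^ 4) ^ c₂ *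
          (2 ^ kolmogorovC D (e A) * (2 * A.card)) := by
        refine h.trans (Nat.mul_le_mul (Nat.pow_le_pow_left (by omega) _) ?_)
        rw [pow_add]
        exact Nat.mul_le_mul_left _ (two_pow_clog_le hA1)
      calc (2 : ℝ) ^ kolmogorovC D x ≤ (((x.length : ℝ) + 2) ^ 4) ^ c₂ *
            (2 ^ kolmogorovC D (e A) * (2 * A.card)) := by exact_mod_cast h'
        _ = ((x.length : ℝ) + 2) ^ (4 * c₂) * 2 * (2 ^ kolmogorovC D (e A) * A.card) := by
            rw [pow_mul]
            ring
        _ ≤ ((x.length : ℝ) + 2) ^ (4 * c₂) * ((x.length : ℝ) + 2) *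
            (2 ^ kolmogorovC D (e A) * A.card) := by gcongr
        _ = ((x.length : ℝ) + 2) ^ (4 * c₂ + 1) * (2 ^ kolmogorovC D (e A) * A.card) := by ring
        _ ≤ _ := mul_le_mul_of_nonneg_right
            (pow_le_pow_right₀ (by linarith) (Nat.le_add_right _ _)) (by positivity)
    -- A model of complexity above 4n is already more complex than `x`, up to a constant.
    · calc (2 : ℝ) ^ kolmogorovC D x ≤ 2 ^ (kolmogorovC D (e A) + c₃) := by
            refine pow_le_pow_right₀ (by norm_num) ?_
            have := hc₃ x
            omega
        _ = 2 ^ c₃ * (2 ^ kolmogorovC D (e A) * 1) := by ring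
        _ ≤ ((x.length : ℝ) + 2) ^ c₃ * (2 ^ kolmogorovC D (e A) * A.card) := by
            gcongr
            exact_mod_cast hA1
        _ ≤ _ := mul_le_mul_of_nonneg_right
            (pow_le_pow_right₀ (by linarith) (Nat.le_add_left _ _)) (by positivity)
  calc predictionWeight D m e 𝒜 x x * 2 ^ kolmogorovC D x
      ≤ ((x.length : ℝ) + 2) ^ c₁ * (1 / (2 ^ kolmogorovC D (e A) * A.card)) *
          (((x.length : ℝ) + 2) ^ (4 * c₂ + 1 + c₃) * (2 ^ kolmogorovC D (e A) * A.card)) := by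
        gcongr
    _ = ((x.length : ℝ) + 2) ^ (c₁ + (4 * c₂ + 1 + c₃)) := by
        rw [pow_add _ c₁]
        field_simp

end Weights

/-! ### Comparison of the two neighbourhoods -/

section Neighbourhoods

variable {D : List Bool →. List Bool} {m : List Bool → ℝ} {e : Finset (List Bool) → List Bool}
  {𝒜 : Set (Finset (List Bool))}

theorem optimalityDeficiency_le_iff {x : List Bool} {A : Finset (List Bool)} (hx : x ∈ A) (d : ℝ) :
    optimalityDeficiency D e x A ≤ d ↔
      (2 : ℝ) ^ kolmogorovC D (e A) * A.card ≤ 2 ^ kolmogorovC D x * (2 : ℝ) ^ d := by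
  have hcard : (0 : ℝ) < A.card := by exact_mod_cast Finset.card_pos.2 ⟨x, hx⟩
  have h1 : (2 : ℝ) ^ kolmogorovC D (e A) * A.card =
      (2 : ℝ) ^ ((kolmogorovC D (e A) : ℝ) + Real.logb 2 A.card) := by
    rw [Real.rpow_add (by norm_num), Real.rpow_natCast,
      Real.rpow_logb (by norm_num) (by norm_num) hcard]
  rw [h1, ← Real.rpow_natCast, ← Real.rpow_add (by norm_num),
    Real.rpow_le_rpow_left_iff (by norm_num), optimalityDeficiency]
  constructor <;> intro h <;> linarith

/-- For n ≥ 2 one has n + 2 ≤ n², which doubles the exponent. -/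
theorem add_two_pow_le_rpow_logb (c : ℕ) {n : ℕ} (hn : 2 ≤ n) :
    ((n : ℝ) + 2) ^ c ≤ (2 : ℝ) ^ ((2 * c : ℕ) * Real.logb 2 n) := by
  have hn' : (2 : ℝ) ≤ n := by exact_mod_cast hn
  rw [mul_comm, Real.rpow_mul (by norm_num), Real.rpow_logb (by norm_num) (by norm_num)
    (by linarith), Real.rpow_natCast, pow_mul]
  exact pow_le_pow_left₀ (by linarith) (by nlinarith) c

/-- One model with small deficiency already makes the numerator large, while the denominator is at
most 2^(-C(x)) up to a polynomial factor. -/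
theorem algorithmicNeighborhood_subset (hD : IsOptimalLanguage D) (hm : IsAPrioriProbability m)
    (he : IsSetEncoding e) (h𝒜 : IsDecidableFamily 𝒜) :
    ∃ (c : ℝ) (N : ℕ), ∀ n : ℕ, N ≤ n → ∀ x : List Bool, x.length = n → ∀ d : ℝ,
      algorithmicNeighborhood D e 𝒜 x d ⊆
        probabilisticNeighborhood D m e 𝒜 x (d + c * Real.logb 2 (n : ℝ)) := by
  obtain ⟨c₁, hc₁⟩ := hm.one_le_mul_predictionWeight (e := e) (𝒜 := 𝒜) hD
  obtain ⟨c₂, hc₂⟩ := hm.predictionWeight_self_le hD he h𝒜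
  obtain ⟨c₃, hc₃⟩ := hD.exists_mem_complexity_le he h𝒜
  refine ⟨((2 * (c₁ + c₂) : ℕ) : ℝ), c₃ + 2, ?_⟩
  rintro n hn x rfl d y ⟨A, hA, hAn, hx, hy, hδ⟩
  rw [optimalityDeficiency_le_iff hx] at hδ
  set X := (x.length : ℝ) + 2 with hX
  have hX0 : 0 < X := by positivity
  set Num := predictionWeight D m e 𝒜 x y with hNum
  have hNum0 : 0 ≤ Num := predictionWeight_nonneg hm.1.nonneg x y
  have hkey : 1 ≤ X ^ c₁ * (2 ^ kolmogorovC D x * (2 : ℝ) ^ d) * Num := by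
    rcases le_or_gt (kolmogorovC D (e A)) (4 * x.length) with hC | hC
    · calc (1 : ℝ) ≤ X ^ c₁ * (2 ^ kolmogorovC D (e A) * A.card) * Num :=
            hc₁ x y A (mem_admissibleModels.2 ⟨hAn, hA, hC, hx⟩) hy
        _ ≤ _ := by gcongr
    -- `A` is too complex to be admissible, so `B` replaces it. As n ≥ c₃ + 2, C(B) ≤ 2n + c₃ ≤ 3n,
    -- and |B| ≤ 2^n, so C(B) + log|B| ≤ 4n < C(A).
    · obtain ⟨B, hB, hBn, hxB, hyB, hBC⟩ := hc₃ x.length A hA hAn x hx y hy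
      have hBcard : (B.card : ℝ) ≤ 2 ^ x.length := by
        have h := Finset.card_le_card hBn
        rw [card_bitStrings] at h
        exact_mod_cast h
      have hAcard : (1 : ℝ) ≤ A.card := by exact_mod_cast Finset.card_pos.2 ⟨x, hx⟩
      calc (1 : ℝ) ≤ X ^ c₁ * (2 ^ kolmogorovC D (e B) * B.card) * Num :=
            hc₁ x y B (mem_admissibleModels.2 ⟨hBn, hB, by omega, hxB⟩) hyB
        _ ≤ X ^ c₁ * (2 ^ (3 * x.length) * 2 ^ x.length) * Num := by
            gcongr
            · norm_num
            · omega
        _ = X ^ c₁ * (2 ^ (4 * x.length) * 1) * Num := by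
            rw [← pow_add, mul_one]
            congr 3
            ring
        _ ≤ X ^ c₁ * (2 ^ kolmogorovC D (e A) * A.card) * Num := by
            gcongr
            norm_num
        _ ≤ _ := by gcongr
  have hNumpos : 0 < Num := by
    rcases hNum0.eq_or_lt with h0 | h0
    · rw [← h0, mul_zero] at hkey
      linarith
    · exact h0
  set Den := predictionWeight D m e 𝒜 x x with hDen
  have hDenpos : 0 < Den := hNumpos.trans_le (predictionWeight_le_self hm.1.nonneg x y)
  have hDenle : Den * 2 ^ kolmogorovC D x ≤ X ^ c₂ := hc₂ x
  have hpow : X ^ (c₁ + c₂) ≤ (2 : ℝ) ^ (((2 * (c₁ + c₂) : ℕ) : ℝ) * Real.logb 2 x.length) :=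
    add_two_pow_le_rpow_logb (c₁ + c₂) (by omega)
  change (2 : ℝ) ^ (-(d + _)) ≤ predictionProbability D m e 𝒜 x y
  rw [predictionProbability_eq, le_div_iff₀ hDenpos, Real.rpow_neg (by norm_num),
    inv_mul_le_iff₀ (by positivity), Real.rpow_add (by norm_num)]
  calc Den ≤ Den * (X ^ c₁ * (2 ^ kolmogorovC D x * (2 : ℝ) ^ d) * Num) :=
        le_mul_of_one_le_right hDenpos.le hkey
    _ = (Den * 2 ^ kolmogorovC D x) * (X ^ c₁ * (2 : ℝ) ^ d * Num) := by ring
    _ ≤ X ^ c₂ * (X ^ c₁ * (2 : ℝ) ^ d * Num) := by gcongr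
    _ = (2 : ℝ) ^ d * X ^ (c₁ + c₂) * Num := by ring
    _ ≤ _ := by gcongr

/-- The singleton {x} bounds the denominator from below by about 2^(-C(x)), and the numerator is
dominated by one model containing both strings; a large ratio forces that model to have small
deficiency. -/
theorem probabilisticNeighborhood_subset (hD : IsOptimalLanguage D) (hm : IsAPrioriProbability m)
    (he : IsSetEncoding e) (h𝒜 : IsDecidableFamily 𝒜) (hsingle : ∀ x : List Bool, {x} ∈ 𝒜) :
    ∃ c : ℝ, ∀ n : ℕ, 2 ≤ n → ∀ x : List Bool, x.length = n → ∀ d : ℝ,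
      probabilisticNeighborhood D m e 𝒜 x d ⊆
        algorithmicNeighborhood D e 𝒜 x (d + c * Real.logb 2 (n : ℝ)) := by
  obtain ⟨c₁, hc₁⟩ := hm.one_le_mul_predictionWeight (e := e) (𝒜 := 𝒜) hD
  obtain ⟨c₂, hc₂⟩ := hm.exists_predictionWeight_le hD he h𝒜
  obtain ⟨c₃, hc₃⟩ := hD.complexity_singleton_le he
  obtain ⟨c₄, hc₄⟩ := hD.complexity_le_length
  -- The second summand serves only lengths below c₃ + c₄, for which {x} might not be admissible.
  refine ⟨((2 * (c₁ + c₂ + c₃) : ℕ) : ℝ) + ((5 * (c₃ + c₄) : ℕ) : ℝ), ?_⟩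
  rintro n hn x rfl d y hy
  change (2 : ℝ) ^ (-d) ≤ predictionProbability D m e 𝒜 x y at hy
  rw [predictionProbability_eq] at hy
  set X := (x.length : ℝ) + 2 with hX
  have hX2 : 2 ≤ X := by linarith [(x.length.cast_nonneg : (0 : ℝ) ≤ x.length)]
  set Num := predictionWeight D m e 𝒜 x y with hNum
  set Den := predictionWeight D m e 𝒜 x x with hDen
  have hNum0 : 0 ≤ Num := predictionWeight_nonneg hm.1.nonneg x y
  have hle : Num ≤ Den := predictionWeight_le_self hm.1.nonneg x y
  have hpos : 0 < Num / Den := lt_of_lt_of_le (by positivity) hy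
  have hNumpos : 0 < Num := hNum0.lt_of_ne fun h => by
    rw [← h, zero_div] at hpos
    exact lt_irrefl _ hpos
  have hDenpos : 0 < Den := hNumpos.trans_le hle
  have hlog : 1 ≤ Real.logb 2 x.length := by
    rw [Real.le_logb_iff_rpow_le (by norm_num) (by exact_mod_cast (by omega : 0 < x.length)),
      Real.rpow_one]
    exact_mod_cast hn
  rcases le_or_gt (c₃ + c₄) x.length with hlarge | hsmall
  · have hadm : {x} ∈ admissibleModels D e 𝒜 x := by
      refine mem_admissibleModels.2 ⟨?_, hsingle x, ?_, Finset.mem_singleton_self x⟩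
      · exact Finset.singleton_subset_iff.2 (mem_bitStrings.2 rfl)
      · have := hc₃ x
        have := hc₄ x
        omega
    have hDen1 : 1 ≤ X ^ c₁ * (2 ^ c₃ * 2 ^ kolmogorovC D x) * Den := by
      calc (1 : ℝ) ≤ X ^ c₁ * (2 ^ kolmogorovC D (e {x}) * ({x} : Finset (List Bool)).card) * Den :=
            hc₁ x x {x} hadm (Finset.mem_singleton_self x)
        _ ≤ _ := by
            rw [Finset.card_singleton, Nat.cast_one, mul_one, ← pow_add]
            gcongr
            · norm_num
            · have := hc₃ x
              omega
    obtain ⟨A, hA, hAn, hxA, hyA, hAle⟩ := hc₂ x y hNumpos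
    have hcard : (0 : ℝ) < A.card := by exact_mod_cast Finset.card_pos.2 ⟨x, hxA⟩
    refine ⟨A, hA, hAn, hxA, hyA, ?_⟩
    rw [optimalityDeficiency_le_iff hxA]
    rw [mul_one_div, le_div_iff₀ (by positivity)] at hAle
    rw [le_div_iff₀ hDenpos, Real.rpow_neg (by norm_num), inv_mul_le_iff₀ (by positivity)] at hy
    have hpow : X ^ (c₁ + c₂ + c₃) ≤
        (2 : ℝ) ^ (((2 * (c₁ + c₂ + c₃) : ℕ) : ℝ) * Real.logb 2 x.length) :=
      add_two_pow_le_rpow_logb _ hn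
    set W := (2 : ℝ) ^ kolmogorovC D (e A) * A.card with hW
    have hW0 : 0 ≤ W := by positivity
    calc W ≤ (X ^ c₁ * (2 ^ c₃ * 2 ^ kolmogorovC D x) * Den) * W :=
          le_mul_of_one_le_left hW0 hDen1
      _ ≤ (X ^ c₁ * (2 ^ c₃ * 2 ^ kolmogorovC D x) * ((2 : ℝ) ^ d * Num)) * W := by gcongr
      _ = X ^ c₁ * 2 ^ c₃ * 2 ^ kolmogorovC D x * (2 : ℝ) ^ d * (Num * W) := by ring
      _ ≤ X ^ c₁ * X ^ c₃ * 2 ^ kolmogorovC D x * (2 : ℝ) ^ d * X ^ c₂ := by gcongr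
      _ = 2 ^ kolmogorovC D x * ((2 : ℝ) ^ d * X ^ (c₁ + c₂ + c₃)) := by ring
      _ ≤ 2 ^ kolmogorovC D x * ((2 : ℝ) ^ d *
            (2 : ℝ) ^ (((2 * (c₁ + c₂ + c₃) : ℕ) : ℝ) * Real.logb 2 x.length)) := by gcongr
      _ ≤ _ := by
          rw [← Real.rpow_add (by norm_num)]
          gcongr
          · norm_num
          · exact le_add_of_nonneg_right (Nat.cast_nonneg _)
  -- For short `x`, a probability is at most 1, so d ≥ 0, and any admissible model containing both
  -- strings has deficiency at most 4n + n = 5n, which is below the constant; log n ≥ 1 lets the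
  -- constant be multiplied by log n.
  · have hd : 0 ≤ d := by
      have h1 : (2 : ℝ) ^ (-d) ≤ 2 ^ (0 : ℝ) := by
        rw [Real.rpow_zero]
        exact hy.trans ((div_le_one hDenpos).2 hle)
      have := (Real.rpow_le_rpow_left_iff (by norm_num)).1 h1
      linarith
    obtain ⟨A, hA, hyA⟩ := exists_model_of_predictionWeight_pos hNumpos
    obtain ⟨hAn, hA𝒜, hAC, hxA⟩ := mem_admissibleModels.1 hA
    refine ⟨A, hA𝒜, hAn, hxA, hyA, ?_⟩
    have hlogA : Real.logb 2 A.card ≤ x.length := by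
      have hcard : (0 : ℝ) < A.card := by exact_mod_cast Finset.card_pos.2 ⟨x, hxA⟩
      rw [Real.logb_le_iff_le_rpow (by norm_num) hcard, Real.rpow_natCast]
      have h := Finset.card_le_card hAn
      rw [card_bitStrings] at h
      exact_mod_cast h
    have hAC' : (kolmogorovC D (e A) : ℝ) ≤ 4 * x.length := by exact_mod_cast hAC
    have hsmall' : (5 : ℝ) * x.length ≤ ((5 * (c₃ + c₄) : ℕ) : ℝ) := by
      exact_mod_cast (by omega : 5 * x.length ≤ 5 * (c₃ + c₄))
    have hx0 : (0 : ℝ) ≤ kolmogorovC D x := Nat.cast_nonneg _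
    have hmul : ((5 * (c₃ + c₄) : ℕ) : ℝ) ≤ (((2 * (c₁ + c₂ + c₃) : ℕ) : ℝ) +
        ((5 * (c₃ + c₄) : ℕ) : ℝ)) * Real.logb 2 x.length := by
      refine le_trans ?_ (le_mul_of_one_le_right (by positivity) hlog)
      exact le_add_of_nonneg_left (Nat.cast_nonneg _)
    rw [optimalityDeficiency]
    linarith

end Neighbourhoods

theorem mainTheorem8
    (D : List Bool →. List Bool) (hD : IsOptimalLanguage D)
    (m : List Bool → ℝ) (hm : IsAPrioriProbability m)
    (e : Finset (List Bool) → List Bool) (he : IsSetEncoding e)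
    (𝒜 : Set (Finset (List Bool))) (h𝒜 : IsDecidableFamily 𝒜)
    (hsingle : ∀ x : List Bool, {x} ∈ 𝒜) :
    (∃ (c : ℝ) (N : ℕ), ∀ n : ℕ, N ≤ n → ∀ x : List Bool, x.length = n → ∀ d : ℝ,
      algorithmicNeighborhood D e 𝒜 x d ⊆
        probabilisticNeighborhood D m e 𝒜 x (d + c * Real.logb 2 (n : ℝ))) ∧
    (∃ c : ℝ, ∀ n : ℕ, 2 ≤ n → ∀ x : List Bool, x.length = n → ∀ d : ℝ,
      probabilisticNeighborhood D m e 𝒜 x d ⊆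
        algorithmicNeighborhood D e 𝒜 x (d + c * Real.logb 2 (n : ℝ))) :=
  ⟨algorithmicNeighborhood_subset hD hm he h𝒜,
    probabilisticNeighborhood_subset hD hm he h𝒜 hsingle⟩
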